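/- Consider a planar billiard system: a fixed body $B_1\subset\mathbb{R}^2$ (a closed set) and a moving disc $B$ of radius $R>0$, centred at the origin in its reference configuration, carrying a finite rotationally symmetric mass distribution $\mu$ that is not concentrated at the centre. Let $m=\mu(B)$ and $\lambda=\frac1m\int_B b_1^2\,d\mu(b)$, so that the inertia matrix (second moments of $\mu$ divided by $m$) is $\lambda I$. The configuration space $M$ is the closure in $SE(2)=SO(2)\ltimes\mathbb{R}^2$ of the set of $g=(A,a)$ with $g(B)\cap B_1=\emptyset$. Assume that $M$ is a submanifold with smooth boundary, and that in each boundary configuration the bodies touch at exactly one point. Identify $T\,SE(2)$ with $SE(2)\times\mathfrak{se}(2)$ by left translation, with elements $(A,a,Z,z)$, and put on $M$ the kinetic energy metric $$\langle (Z,z),(Z',z')\rangle=m\left[\lambda\,\mathrm{Tr}(Z Z'^{\dagger})+z\cdot z'\right].$$ At $q=(A,a)\in\partial M$ with contact point $b\in B_1$, let $b_\circ=A^{-1}(b-a)\in\partial B$, and let $\Pi_\circ$, $\Pi_\circ^\perp$ be the orthogonal projections onto the tangent line to $\partial B$ at $b_\circ$ and onto $\mathbb{R}b_\circ$. The completely rough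 collision map is the map with $\mathcal{T}=-I$ in $$(Z,z)\mapsto\left(Z-\tfrac{\alpha}{2\lambda}\,b_\circ\wedge (I-\mathcal{T})V,\; z-\alpha (I-\mathcal{T})V-2\Pi_\circ^\perp z\right),\qquad V=\Pi_\circ(Zb_\circ+z),\quad \alpha=\frac{1}{1+R^2/2\lambda},$$ where $(u\wedge w)_{ij}=u_jw_i-u_iw_j$. Between collisions the motion is free: $(A,a,Z,z)\mapsto(Ae^{tZ},a+tAz,Z,e^{-tZ}z)$. Fix an energy $\mathcal{E}>0$ and let $N^{\mathcal{E}}_+$ be the set of states $(q,v)$ with $q\in\partial M$, $\frac12\|v\|_q^2=\mathcal{E}$ and $v$ pointing strictly into $M$. The billiard map $T$ sends a state in $N^{\mathcal{E}}_+$ to the post-collision state at the next collision; its domain $D\subset N^{\mathcal{E}}_+$ consists of the states that have a next collision, that collision being non-tangential. The canonical billiard measure is the measure $|\Omega|$ on $N_+^{\mathcal{E}}$ associated to the pull-back of the $4$-form $\Omega=d\theta\wedge d\theta$, where $\theta_v(\xi)=\langle v,d\pi_v\xi\rangle$ and $\pi:TM\to M$ is the projection. Then the billiard map with completely rough collisions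 preserves the canonical billiard measure: $D$ is measurable, $T:D\to N^{\mathcal{E}}_+$ is injective, and for every measurable $S\subseteq D$ the set $T(S)$ is measurable with $|\Omega|(T(S))=|\Omega|(S)$. In particular, whenever $D$ has full $|\Omega|$-measure, $T$ is a measure-preserving transformation of $(N^{\mathcal{E}}_+,|\Omega|)$. -/

import Mathlib

open MeasureTheory
open scoped ContDiff

noncomputable section

/-!
The plane `ℝ²` is identified with `ℂ`; then `SO(2)` is the unit circle acting by multiplication,
the generator `J` of `𝔰𝔬(2)` (rotation by `π/2`) is multiplication by `Complex.I`, and an element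
`Z = ω J` of `𝔰𝔬(2)` is recorded by the real number `ω`.
-/

namespace RoughBilliard

/-- The Euclidean group `SE(2) = SO(2) ⋉ ℝ²`: the pair `(A, a)` acts by `b ↦ A b + a`. -/
abbrev Config : Type := Circle × ℂ

/-- The Lie algebra `𝔰𝔢(2)`: the pair `(ω, z)` stands for `(Z, z)` with `Z = ω J`. -/
abbrev Vel : Type := ℝ × ℂ

/-- States: the tangent bundle of `SE(2)`, trivialised by left translation. The state
`((A, a), (ω, z))` has velocity `(A Z, A z)`, so `A z` is the velocity of the centre of mass. -/
abbrev State : Type := Config × Vel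

instance : MeasurableSpace Circle := borel Circle

instance : BorelSpace Circle := ⟨rfl⟩

/-- The vector space in which the tangent bundle `SE(2) × 𝔰𝔢(2)` is embedded, as the set of the
`((A, a), (ω, z))` with `|A| = 1`. -/
abbrev Ambient : Type := (ℂ × ℂ) × (ℝ × ℂ)

/-- The inclusion of the state space. -/
def embed (x : State) : Ambient := (((x.1.1 : ℂ), x.1.2), x.2)

/-- Euclidean inner product of the plane. -/
def dot (u w : ℂ) : ℝ := u.re * w.re + u.im * w.im

/-- `u ∧ w = wedge u w • J` in `𝔰𝔬(2)`, where `(u ∧ w)ᵢⱼ = uⱼ wᵢ - uᵢ wⱼ`. -/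
def wedge (u w : ℂ) : ℝ := u.re * w.im - u.im * w.re

/-- Position of the material point `b` in configuration `(A, a)`. -/
def place (q : Config) (b : ℂ) : ℂ := (q.1 : ℂ) * b + q.2

/-- Velocity, in the body frame, of the material point `b` for `ξ = (Z, z)`: `Z b + z`. -/
def pointVelocity (ξ : Vel) (b : ℂ) : ℂ := (ξ.1 : ℂ) * Complex.I * b + ξ.2

/-- The data of a planar billiard system: a fixed body `table`, and a moving disc with centre of
mass `0` in its reference configuration, with its radius and its mass distribution. -/
structure DiscBilliard where
  table : Set ℂ
  radius : ℝ
  massDist : Measure ℂ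

namespace DiscBilliard

variable (β : DiscBilliard)

/-- The moving body in reference configuration. -/
def disc : Set ℂ := Metric.closedBall 0 β.radius

/-- The configuration space `M`: closure of the set of configurations in which the disc and the
fixed body are disjoint. -/
def configSpace : Set Config := closure {q | Disjoint (place q '' β.disc) β.table}

/-- The boundary `∂M`: the collision configurations. -/
def boundary : Set Config := frontier β.configSpace

/-- `b` is a common point of the fixed body and of the disc in configuration `q`. -/
def IsContact (q : Config) (b : ℂ) : Prop := b ∈ β.table ∧ b ∈ place q '' β.disc

/-- The contact point in a boundary configuration (there is only one, see `Regular`). -/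
def contactPoint (q : Config) : ℂ := Classical.epsilon (β.IsContact q)

/-- The contact point as a material point `b_∘ = q⁻¹ b` of the disc in reference configuration. -/
def bodyContact (q : Config) : ℂ := ((q.1⁻¹ : Circle) : ℂ) * (β.contactPoint q - q.2)

/-- Outward unit normal to the disc at the contact point, in the body frame. -/
def bodyNormal (q : Config) : ℂ := ((β.radius⁻¹ : ℝ) : ℂ) * β.bodyContact q

/-- Total mass `m`. -/
def mass : ℝ := β.massDist.real Set.univ

/-- The inertia matrix (second moments divided by the mass) of a rotationally symmetric mass
distribution is the scalar matrix `λ I`; this is `λ`. -/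
def inertia : ℝ := (∫ b, b.re ^ 2 ∂β.massDist) / β.mass

/-- The kinetic energy metric in the left trivialisation,
`m (½ Tr (𝓛(Z) Z'ᵀ) + z ⬝ z')` with `𝓛(Z) = 2 λ Z`. -/
def metric (ξ η : Vel) : ℝ :=
  β.mass * (2 * β.inertia * (ξ.1 * η.1) + dot ξ.2 η.2)

/-- Kinetic energy. -/
def energy (ξ : Vel) : ℝ := β.metric ξ ξ / 2

/-- Standing assumptions. The conditions on the mass distribution say that it is finite, carried
by the disc, rotationally symmetric, and not concentrated at the centre (so that the kinetic
energy metric is positive definite). The last two conditions say that boundary configurations have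
a unique contact point, and that `M` is a submanifold of `SE(2)` with smooth boundary: in the
coordinates `(s, x) ↦ (A e^{is}, x)` around a boundary configuration `(A, a)` it is `{f ≥ 0}` for
a smooth `f` with non-vanishing differential. -/
structure Regular : Prop where
  radius_pos : 0 < β.radius
  table_closed : IsClosed β.table
  mass_finite : IsFiniteMeasure β.massDist
  mass_carried : β.massDist β.discᶜ = 0
  mass_symm : ∀ c : Circle, β.massDist.map (fun b => (c : ℂ) * b) = β.massDist
  mass_nondeg : β.massDist {0}ᶜ ≠ 0
  unique_contact : ∀ q ∈ β.boundary, ∃! b, β.IsContact q b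
  smooth_boundary : ∀ q ∈ β.boundary, ∃ (W : Set (ℝ × ℂ)) (f : ℝ × ℂ → ℝ),
    IsOpen W ∧ (0, q.2) ∈ W ∧ ContDiffOn ℝ ∞ f W ∧ fderiv ℝ f (0, q.2) ≠ 0 ∧
      ∀ p ∈ W, (q.1 * Circle.exp p.1, p.2) ∈ β.configSpace ↔ 0 ≤ f p

/-- The collision map in the body frame attached to a linear involution `𝒯` of the tangent line to
the disc at the contact point. With `V = Π (Z b_∘ + z)` the tangential part of the velocity of the
contact point and `α = 1 / (1 + R² / (2 λ))`, it is
`(Z, z) ↦ (Z - (α / 2λ) b_∘ ∧ (I - 𝒯) V, z - α (I - 𝒯) V - 2 Π^⊥ z)`. -/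
def collisionMap (𝒯 : ℂ →ₗ[ℝ] ℂ) (q : Config) (ξ : Vel) : Vel :=
  let b := β.bodyContact q
  let n := β.bodyNormal q
  let α : ℝ := 1 / (1 + β.radius ^ 2 / (2 * β.inertia))
  let V : ℂ := pointVelocity ξ b - dot (pointVelocity ξ b) n • n
  (ξ.1 - α / (2 * β.inertia) * wedge b (V - 𝒯 V),
    ξ.2 - α • (V - 𝒯 V) - (2 * dot ξ.2 n) • n)

/-- The completely rough collision map, `𝒯 = -I`. -/
def roughCollision (q : Config) (ξ : Vel) : Vel := β.collisionMap (-LinearMap.id) q ξ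

/-- The completely rough collision map is the identity on the non-slipping subspace (contact
point at rest) and minus the identity on the impulse subspace
`{(𝓛⁻¹ (b_∘ ∧ u), u)}`. These are complementary, so this characterises it. -/
theorem roughCollision_spec (q : Config) (hR : 0 < β.radius) (hl : 0 < β.inertia)
    (hb : dot (β.bodyContact q) (β.bodyContact q) = β.radius ^ 2) :
    (∀ ξ : Vel, pointVelocity ξ (β.bodyContact q) = 0 → β.roughCollision q ξ = ξ) ∧
    ∀ u : ℂ, β.roughCollision q (wedge (β.bodyContact q) u / (2 * β.inertia), u) =
      -(wedge (β.bodyContact q) u / (2 * β.inertia), u) := by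
  have hn : β.radius ≠ 0 := hR.ne'
  have hl' : β.inertia ≠ 0 := hl.ne'
  have hd : 2 * β.inertia + β.radius ^ 2 ≠ 0 := by positivity
  unfold roughCollision collisionMap bodyNormal
  generalize β.bodyContact q = b at *
  generalize β.radius = R at *
  generalize β.inertia = l at *
  obtain ⟨x, y⟩ := b
  simp only [dot] at hb
  constructor
  · rintro ⟨w, z1, z2⟩ h
    dsimp only
    rw [h]
    have h1 := congrArg Complex.re h
    have h2 := congrArg Complex.im h
    simp [pointVelocity] at h1 h2
    have e1 : z1 = w * y := by linarith
    have e2 : z2 = -(w * x) := by linarith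
    subst e1 e2
    refine Prod.ext ?_ (Complex.ext ?_ ?_) <;> simp [dot, wedge] <;> ring_nf <;> simp
  · rintro ⟨u1, u2⟩
    obtain ⟨c, rfl⟩ : ∃ c, x = R * c := ⟨x / R, by field_simp⟩
    obtain ⟨s, rfl⟩ : ∃ s, y = R * s := ⟨y / R, by field_simp⟩
    have h1 : c ^ 2 + s ^ 2 = 1 := by
      have : R ^ 2 * (c ^ 2 + s ^ 2) = R ^ 2 * 1 := by linarith
      exact mul_left_cancel₀ (pow_ne_zero 2 hn) this
    obtain ⟨p, t, rfl, rfl⟩ : ∃ p t, u1 = p * c - t * s ∧ u2 = p * s + t * c :=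
      ⟨u1 * c + u2 * s, u2 * c - u1 * s, by linear_combination (-u1) * h1,
        by linear_combination (-u2) * h1⟩
    have hw : wedge ⟨R * c, R * s⟩ ⟨p * c - t * s, p * s + t * c⟩ = R * t := by
      simp only [wedge]
      linear_combination (R * t) * h1
    have hN : ((R⁻¹ : ℝ) : ℂ) * ⟨R * c, R * s⟩ = ⟨c, s⟩ := by
      apply Complex.ext <;> simp [hn]
    have hP : pointVelocity (R * t / (2 * l), ⟨p * c - t * s, p * s + t * c⟩) ⟨R * c, R * s⟩ =
        ⟨p * c - (t * (1 + R ^ 2 / (2 * l))) * s, p * s + (t * (1 + R ^ 2 / (2 * l))) * c⟩ := by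
      apply Complex.ext <;>
        simp only [pointVelocity, Complex.add_re, Complex.add_im, Complex.mul_re, Complex.mul_im,
          Complex.ofReal_re, Complex.ofReal_im, Complex.I_re, Complex.I_im] <;> field_simp <;> ring
    have hα : 1 + R ^ 2 / (2 * l) ≠ 0 := by positivity
    dsimp only
    rw [hw, hN, hP]
    generalize hk : 1 + R ^ 2 / (2 * l) = k at *
    have hD : dot ⟨p * c - t * k * s, p * s + t * k * c⟩ ⟨c, s⟩ = p := by
      simp only [dot]
      linear_combination p * h1
    have hD' : dot ⟨p * c - t * s, p * s + t * c⟩ ⟨c, s⟩ = p := by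
      simp only [dot]
      linear_combination p * h1
    have hV : (⟨p * c - t * k * s, p * s + t * k * c⟩ : ℂ) - p • (⟨c, s⟩ : ℂ) =
        ⟨-(t * k * s), t * k * c⟩ := by
      apply Complex.ext <;> simp
    rw [hD, hD', hV]
    refine Prod.ext ?_ (Complex.ext ?_ ?_)
    · simp [wedge]
      field_simp
      linear_combination (-2 * t) * h1
    · simp
      field_simp
      ring
    · simp
      field_simp
      ring

/-- Free motion during time `t`. -/
def freeMotion (t : ℝ) (x : State) : State :=
  ((x.1.1 * Circle.exp (t * x.2.1), x.1.2 + t • ((x.1.1 : ℂ) * x.2.2)),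
    (x.2.1, ((Circle.exp (-(t * x.2.1)) : Circle) : ℂ) * x.2.2))

/-- Post-collision states of energy `E` that are not tangent to the boundary: the velocity of the
centre of mass points strictly into the region of free motion. -/
def postCollision (E : ℝ) : Set State :=
  {x | x.1 ∈ β.boundary ∧ β.energy x.2 = E ∧ dot x.2.2 (β.bodyNormal x.1) < 0}

/-- The positive times at which the free motion from `x` is in a collision configuration. -/
def hitTimes (x : State) : Set ℝ := {t | 0 < t ∧ (freeMotion t x).1 ∈ β.boundary}

/-- The pre-collision state at the next collision. -/
def nextPreCollision (x : State) : State := freeMotion (sInf (β.hitTimes x)) x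

/-- Domain of the billiard map: the states that do have a next collision, and for which that
collision is not tangential. -/
def domain (E : ℝ) : Set State :=
  {x | x ∈ β.postCollision E ∧ (β.hitTimes x).Nonempty ∧
    0 < dot (β.nextPreCollision x).2.2 (β.bodyNormal (β.nextPreCollision x).1)}

open Classical in
/-- The billiard map with completely rough collisions: from a post-collision state to the
post-collision state at the next collision (extended by the identity off its domain). -/
def billiardMap (E : ℝ) (x : State) : State :=
  if x ∈ β.domain E then
    ((β.nextPreCollision x).1,
      β.roughCollision (β.nextPreCollision x).1 (β.nextPreCollision x).2)
  else x

/-- The contact form `θ_v(X) = ⟨v, dπ_v X⟩`. For `X = ((A', a'), (ω', z'))` the left translate of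
`dπ X = (A', a')` to `𝔰𝔢(2)` is `(A⁻¹ A', A⁻¹ a')`, with `A⁻¹` the conjugate of `A`. The formula
extends `θ` to the ambient vector space. -/
def contactForm (x X : Ambient) : ℝ :=
  β.metric x.2 ((star x.1.1 * X.1.1).im, star x.1.1 * X.1.2)

/-- The exterior derivative `dθ`. -/
def symplecticForm (x X Y : Ambient) : ℝ :=
  fderiv ℝ (fun y => β.contactForm y Y) x X - fderiv ℝ (fun y => β.contactForm y X) x Y

/-- The form `Ω = dθ ∧ dθ`, of the dimension `4` of the energy level over `∂M`. -/
def liouvilleForm (x : Ambient) (X : Fin 4 → Ambient) : ℝ :=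
  2 * (β.symplecticForm x (X 0) (X 1) * β.symplecticForm x (X 2) (X 3)
    - β.symplecticForm x (X 0) (X 2) * β.symplecticForm x (X 1) (X 3)
    + β.symplecticForm x (X 0) (X 3) * β.symplecticForm x (X 1) (X 2))

/-- Smooth injective parametrisations of pieces of the `4`-manifold of post-collision states.
Immersivity need not be demanded: critical points carry no mass below. -/
structure Param (E : ℝ) where
  source : Set (Fin 4 → ℝ)
  toFun : (Fin 4 → ℝ) → State
  isOpen : IsOpen source
  mapsTo : Set.MapsTo toFun source (β.postCollision E)
  injOn : Set.InjOn toFun source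
  smooth : ContDiffOn ℝ ∞ (fun u => embed (toFun u)) source

/-- The density `|φ^* Ω|` with respect to Lebesgue measure in a parametrisation `φ`. -/
def density {E : ℝ} (φ : β.Param E) (u : Fin 4 → ℝ) : ℝ :=
  |β.liouvilleForm (embed (φ.toFun u))
    (fun i => fderiv ℝ (fun w => embed (φ.toFun w)) u (Pi.single i 1))|

/-- The canonical billiard measure at energy `E`: the measure `|Ω|` associated to the form `Ω`,
that is, the measure that is `|φ^* Ω|` in each parametrisation `φ`; it is the least measure
that dominates all of these. -/
def billiardMeasure (E : ℝ) : Measure State :=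
  ⨆ φ : β.Param E, ((volume.restrict φ.source).withDensity
    (fun u => ENNReal.ofReal (β.density φ u))).map φ.toFun

end DiscBilliard

end RoughBilliard

end

/-! A rotation does not change a disc, so $M$ is $SO(2)$ times the set `region` of admissible
centres, and $\partial M$ is governed by the boundary of that planar region. In the coordinates
angle $\varphi$, centre $a$, spin $s$ and velocity $w$ of the centre in the fixed frame, $\theta =
m(2\lambda s\,d\varphi + w\cdot da)$, hence $d\theta = m(2\lambda\,ds\wedge d\varphi + dw\wedge
da)$, with constant coefficients.

Free motion during a variable time $\tau$ changes $d\theta$ by $dE\wedge d\tau$, which vanishes on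
an energy level (`pullbackDensity_freeMotion`). At a collision the centre moves along the boundary,
so only the tangential part $r$ of $dw$ is seen, and $\Omega$ is a constant times $ds\wedge
d\varphi\wedge r\wedge d\sigma$ with $\sigma$ the arc length. The rough collision acts on $(ds, r)$
by a matrix of determinant $-1$, up to multiples of $d\sigma$ coming from the curvature of the
boundary; these disappear in the product (`pullbackDensity_collide`). Thus $\Omega$ changes sign and
$|\Omega|$ is preserved.

Transversality of the arrival and the implicit function theorem make the return time smooth
(`exists_return_time`), so the billiard map carries parametrisations to parametrisations. As the
measure is a supremum over parametrisations, this yields only $|\Omega|(S)\le|\Omega|(T(S))$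
(`measure_le`). The opposite inequality comes from time reversal: the involution $J$ = collision
followed by reversal of the velocity preserves $|\Omega|$, and $TJT=J$ on $D$
(`timeReversal_billiardMap`). The same identity gives injectivity of $T$ and shows that its image
has full measure when $D$ does. -/

noncomputable section

open Set Filter Topology Metric

/-! ### The region of centres, its boundary charts and its normal -/

namespace RoughBilliard

lemma dot_comm (u w : ℂ) : dot u w = dot w u := by simp [dot, mul_comm]

lemma dot_add_left (u v w : ℂ) : dot (u + v) w = dot u w + dot v w := by
  simp [dot]; ring

lemma dot_smul_left (r : ℝ) (u w : ℂ) : dot (r • u) w = r * dot u w := by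
  simp [dot]; ring

lemma dot_neg_left (u w : ℂ) : dot (-u) w = -dot u w := by
  simp [dot]; ring

lemma dot_self (u : ℂ) : dot u u = ‖u‖ ^ 2 := by
  rw [Complex.sq_norm, Complex.normSq_apply, dot]

lemma continuous_dot : Continuous fun p : ℂ × ℂ => dot p.1 p.2 := by
  unfold dot; fun_prop

lemma contDiff_dot : ContDiff ℝ ∞ fun p : ℂ × ℂ => dot p.1 p.2 := by
  unfold dot
  have hre : ContDiff ℝ ∞ fun z : ℂ => z.re := Complex.reCLM.contDiff
  have him : ContDiff ℝ ∞ fun z : ℂ => z.im := Complex.imCLM.contDiff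
  exact ((hre.comp contDiff_fst).mul (hre.comp contDiff_snd)).add
    ((him.comp contDiff_fst).mul (him.comp contDiff_snd))

lemma dot_conj_mul (A z w : ℂ) : dot z (star A * w) = dot (A * z) w := by
  simp [dot]; ring

lemma eq_dot_smul_add {n : ℂ} (hn : dot n n = 1) (v : ℂ) :
    v = dot v n • n + dot v (Complex.I * n) • (Complex.I * n) := by
  simp only [dot] at hn
  apply Complex.ext
  · simp [dot]; linear_combination (-v.re) * hn
  · simp [dot]; linear_combination (-v.im) * hn

/-- A function with positive derivative in the direction `v` at `x` is strictly increasing along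
short pieces of all lines close to the line through `x` in the direction `v`. -/
lemma eventually_strictMonoOn_line {W : Set ℂ} {g : ℂ → ℝ} (hW : IsOpen W)
    (hg : ContDiffOn ℝ ∞ g W) {x v : ℂ} (hx : x ∈ W) (hv : 0 < fderiv ℝ g x v) :
    ∃ ε > 0, ∀ᶠ p : ℂ × ℂ in 𝓝 (x, v), (∀ t ∈ Icc (-ε) ε, p.1 + t • p.2 ∈ W) ∧
      StrictMonoOn (fun t : ℝ => g (p.1 + t • p.2)) (Icc (-ε) ε) := by
  have hline : Tendsto (fun y : (ℂ × ℂ) × ℝ => y.1.1 + y.2 • y.1.2) (𝓝 ((x, v), 0)) (𝓝 x) := by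
    have : Continuous fun y : (ℂ × ℂ) × ℝ => y.1.1 + y.2 • y.1.2 := by fun_prop
    simpa using this.tendsto ((x, v), 0)
  have hfd : ContinuousAt (fderiv ℝ g) x :=
    (hg.continuousOn_fderiv_of_isOpen hW (by simp)).continuousAt (hW.mem_nhds hx)
  have hder : Tendsto (fun y : (ℂ × ℂ) × ℝ => fderiv ℝ g (y.1.1 + y.2 • y.1.2) y.1.2)
      (𝓝 ((x, v), 0)) (𝓝 (fderiv ℝ g x v)) := by
    have h2 : Continuous fun y : (ℂ × ℂ) × ℝ => y.1.2 := by fun_prop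
    have h3 : ContinuousAt (fun y : (ℂ × ℂ) × ℝ => fderiv ℝ g (y.1.1 + y.2 • y.1.2))
        ((x, v), 0) := by
      simpa [ContinuousAt, Function.comp_def] using Tendsto.comp hfd.tendsto hline
    simpa [ContinuousAt] using (h3.clm_apply h2.continuousAt).tendsto
  have hev := (hline.eventually (hW.mem_nhds hx)).and (hder.eventually (lt_mem_nhds hv))
  rw [nhds_prod_eq] at hev
  obtain ⟨P, hP, Q, hQ, hPQ⟩ := eventually_prod_iff.1 hev
  obtain ⟨ε, hε, hball⟩ := Metric.eventually_nhds_iff.1 hQ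
  refine ⟨ε / 2, half_pos hε, hP.mono fun p hp => ?_⟩
  have key : ∀ t ∈ Icc (-(ε / 2)) (ε / 2),
      p.1 + t • p.2 ∈ W ∧ 0 < fderiv ℝ g (p.1 + t • p.2) p.2 := fun t ht =>
    hPQ hp (hball (by
      rw [Real.dist_eq, sub_zero, abs_lt]; constructor <;> linarith [ht.1, ht.2]))
  have hd : ∀ t ∈ Icc (-(ε / 2)) (ε / 2), HasDerivAt (fun t : ℝ => g (p.1 + t • p.2))
      (fderiv ℝ g (p.1 + t • p.2) p.2) t := fun t ht => by
    have h1 : HasFDerivAt g (fderiv ℝ g (p.1 + t • p.2)) (p.1 + t • p.2) :=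
      ((hg.differentiableOn (by simp)).differentiableAt
        (hW.mem_nhds (key t ht).1)).hasFDerivAt
    have h2 : HasDerivAt (fun t : ℝ => p.1 + t • p.2) p.2 t := by
      simpa using ((hasDerivAt_id t).smul_const p.2).const_add p.1
    exact h1.comp_hasDerivAt t h2
  refine ⟨fun t ht => (key t ht).1, strictMonoOn_of_deriv_pos (convex_Icc _ _)
    (fun t ht => (hd t ht).continuousAt.continuousWithinAt) fun t ht => ?_⟩
  have ht' := interior_subset ht
  rw [(hd t ht').deriv]
  exact (key t ht').2

namespace DiscBilliard

variable (β : DiscBilliard)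

/-- The set of positions of the centre of the disc in the configurations of `M`. -/
def region : Set ℂ := closure {a | Disjoint (closedBall a β.radius) β.table}

/-- Outward unit normal at the contact point of the disc with centre `a`, in the fixed frame. -/
def normal (a : ℂ) : ℂ := β.bodyNormal (1, a)

lemma isClosed_region : IsClosed β.region := isClosed_closure

lemma place_image_disc (q : Config) : place q '' β.disc = closedBall q.2 β.radius := by
  have h : ∀ b, dist (place q b) q.2 = ‖b‖ := fun b => by
    simp [place, dist_eq_norm, Circle.norm_coe]
  ext c
  constructor
  · rintro ⟨b, hb, rfl⟩
    simpa [h, disc] using hb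
  · intro hc
    have hbc : place q (star (q.1 : ℂ) * (c - q.2)) = c := by
      have : (q.1 : ℂ) * (starRingEnd ℂ) (q.1 : ℂ) = 1 := by
        rw [Complex.mul_conj]; simp
      simp only [place, Complex.star_def]
      linear_combination (c - q.2) * this
    exact ⟨_, by rw [← hbc] at hc; simpa [h, disc] using hc, hbc⟩

/-- The placed disc depends on the centre alone, and closures commute with preimages under the open
projection to the centre. -/
lemma configSpace_eq : β.configSpace = Prod.snd ⁻¹' β.region := by
  simp only [configSpace, region, place_image_disc]
  exact (isOpenMap_snd.preimage_closure_eq_closure_preimage continuous_snd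
    {a | Disjoint (closedBall a β.radius) β.table}).symm

lemma boundary_eq : β.boundary = Prod.snd ⁻¹' frontier β.region := by
  rw [boundary, configSpace_eq,
    isOpenMap_snd.preimage_frontier_eq_frontier_preimage continuous_snd]

lemma mem_boundary {q : Config} : q ∈ β.boundary ↔ q.2 ∈ frontier β.region := by
  rw [boundary_eq]; rfl

lemma isContact_iff {q : Config} {b : ℂ} :
    β.IsContact q b ↔ b ∈ β.table ∧ b ∈ closedBall q.2 β.radius := by
  rw [IsContact, place_image_disc]

lemma contactPoint_eq (q : Config) : β.contactPoint q = β.contactPoint (1, q.2) := by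
  have : β.IsContact q = β.IsContact (1, q.2) := by
    ext b; simp [isContact_iff]
  simp only [contactPoint, this]

lemma bodyNormal_eq (q : Config) : β.bodyNormal q = star (q.1 : ℂ) * β.normal q.2 := by
  simp only [normal, bodyNormal, bodyContact, β.contactPoint_eq q, Circle.coe_inv_eq_conj]
  simp; ring

variable {β}

lemma Regular.bodyContact_eq (hβ : β.Regular) (q : Config) :
    β.bodyContact q = β.radius • β.bodyNormal q := by
  have : (β.radius : ℂ) ≠ 0 := by exact_mod_cast hβ.radius_pos.ne'
  simp [bodyNormal, this]

lemma le_dist_of_mem_region {a b : ℂ} (ha : a ∈ β.region) (hb : b ∈ β.table) :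
    β.radius ≤ dist b a := by
  have hc : IsClosed {a : ℂ | β.radius ≤ dist b a} :=
    isClosed_le continuous_const (by fun_prop)
  refine closure_minimal ?_ hc ha
  intro x hx
  by_contra h
  exact Set.disjoint_left.1 hx (mem_closedBall.2 (not_le.1 h).le) hb

lemma Regular.contactPoint_spec (hβ : β.Regular) {a : ℂ} (ha : a ∈ frontier β.region) :
    β.contactPoint (1, a) ∈ β.table ∧ dist (β.contactPoint (1, a)) a = β.radius := by
  obtain ⟨b, hb, -⟩ := hβ.unique_contact (1, a) (β.mem_boundary.2 ha)
  have h := β.isContact_iff.1 (Classical.epsilon_spec (p := β.IsContact (1, a)) ⟨b, hb⟩)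
  exact ⟨h.1, le_antisymm h.2
    (le_dist_of_mem_region (β.isClosed_region.frontier_subset ha) h.1)⟩

lemma normal_eq (a : ℂ) : β.normal a = β.radius⁻¹ • (β.contactPoint (1, a) - a) := by
  simp [normal, bodyNormal, bodyContact]

lemma Regular.dot_normal_self (hβ : β.Regular) {a : ℂ} (ha : a ∈ frontier β.region) :
    dot (β.normal a) (β.normal a) = 1 := by
  have h := (hβ.contactPoint_spec ha).2
  rw [dist_eq_norm] at h
  rw [dot_self, normal_eq, norm_smul, h, Real.norm_of_nonneg (by simpa using hβ.radius_pos.le),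
    inv_mul_cancel₀ hβ.radius_pos.ne']
  norm_num

/-- A smooth function that cuts out the region of centres of the disc inside `W`. -/
structure BoundaryChart (β : DiscBilliard) (W : Set ℂ) (g : ℂ → ℝ) : Prop where
  isOpen : IsOpen W
  contDiffOn : ContDiffOn ℝ ∞ g W
  mem_iff : ∀ x ∈ W, x ∈ β.region ↔ 0 ≤ g x
  fderiv_ne : ∀ x ∈ W, fderiv ℝ g x ≠ 0

lemma mem_interior_region_of_pos {W : Set ℂ} {g : ℂ → ℝ} (hW : IsOpen W)
    (hg : ContinuousOn g W) (hmem : ∀ x ∈ W, x ∈ β.region ↔ 0 ≤ g x) {x : ℂ} (hx : x ∈ W)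
    (hpos : 0 < g x) : x ∈ interior β.region := by
  rw [mem_interior_iff_mem_nhds]
  filter_upwards [hW.mem_nhds hx,
    (hg.continuousAt (hW.mem_nhds hx)).eventually (lt_mem_nhds hpos)] with y hy hy'
  exact (hmem y hy).2 hy'.le

lemma apply_eq_zero_of_mem_frontier {W : Set ℂ} {g : ℂ → ℝ} (hW : IsOpen W)
    (hg : ContinuousOn g W) (hmem : ∀ x ∈ W, x ∈ β.region ↔ 0 ≤ g x) {x : ℂ} (hx : x ∈ W)
    (hf : x ∈ frontier β.region) : g x = 0 := by
  have h0 := (hmem x hx).1 (β.isClosed_region.frontier_subset hf)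
  by_contra hne
  exact hf.2 (mem_interior_region_of_pos hW hg hmem hx (lt_of_le_of_ne h0 (Ne.symm hne)))

/-- The given defining function on $SE(2)$ cannot vary to first order with the angle, so its
restriction to the plane of centres still has a non-zero differential. Shrinking the neighbourhood
keeps the differential non-zero throughout. -/
lemma Regular.exists_boundaryChart (hβ : β.Regular) {a : ℂ} (ha : a ∈ frontier β.region) :
    ∃ W g, a ∈ W ∧ β.BoundaryChart W g := by
  obtain ⟨W, f, hW, haW, hf, hne, hmem⟩ := hβ.smooth_boundary (1, a) (β.mem_boundary.2 ha)
  simp only [configSpace_eq, mem_preimage] at hmem haW hne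
  have hι : Continuous fun x : ℂ => ((0 : ℝ), x) := by fun_prop
  set W₁ : Set ℂ := (fun x : ℂ => ((0 : ℝ), x)) ⁻¹' W
  have hW₁ : IsOpen W₁ := hW.preimage hι
  have haW₁ : a ∈ W₁ := haW
  set g : ℂ → ℝ := fun x => f (0, x) with hgdef
  have hg : ContDiffOn ℝ ∞ g W₁ := hf.comp (by fun_prop) fun x hx => hx
  have hmem₁ : ∀ x ∈ W₁, x ∈ β.region ↔ 0 ≤ g x := fun x hx => hmem _ hx
  have hga : g a = 0 := apply_eq_zero_of_mem_frontier hW₁ hg.continuousOn hmem₁ haW₁ ha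
  have hfa : HasFDerivAt f (fderiv ℝ f (0, a)) (0, a) :=
    ((hf.differentiableOn (by simp)).differentiableAt (hW.mem_nhds haW)).hasFDerivAt
  have hgfd : HasFDerivAt g ((fderiv ℝ f (0, a)).comp (ContinuousLinearMap.inr ℝ ℝ ℂ)) a :=
    hfa.comp a (hasFDerivAt_prodMk_right (0 : ℝ) a)
  -- Turning the disc about its centre stays in $M$, so `f (·, a)` is non-negative near `0` and
  -- vanishes there: `0` is a local minimum.
  have hs : (fderiv ℝ f (0, a)).comp (ContinuousLinearMap.inl ℝ ℝ ℂ) = 0 := by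
    have h1 : HasFDerivAt (fun s : ℝ => f (s, a))
      ((fderiv ℝ f (0, a)).comp (ContinuousLinearMap.inl ℝ ℝ ℂ)) 0 :=
      HasFDerivAt.comp (f := fun s : ℝ => (s, a)) 0 hfa (hasFDerivAt_prodMk_left (0 : ℝ) a)
    refine IsLocalMin.hasFDerivAt_eq_zero ?_ h1
    have hc : Continuous fun s : ℝ => (s, a) := by fun_prop
    filter_upwards [hc.continuousAt.preimage_mem_nhds (hW.mem_nhds haW)] with s hsW
    change g a ≤ _
    rw [hga]
    exact (hmem _ hsW).1 (β.isClosed_region.frontier_subset ha)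
  have hga' : fderiv ℝ g a ≠ 0 := by
    rw [hgfd.fderiv]
    intro h0
    apply hne
    refine ContinuousLinearMap.ext fun p => ?_
    have e1 := DFunLike.congr_fun hs p.1
    have e2 := DFunLike.congr_fun h0 p.2
    simp only [ContinuousLinearMap.comp_apply, ContinuousLinearMap.inl_apply,
      ContinuousLinearMap.inr_apply, _root_.zero_apply] at e1 e2 ⊢
    have : p = (p.1, 0) + (0, p.2) := by simp
    rw [this, map_add, e1, e2, add_zero]
  have hopen : IsOpen (W₁ ∩ fderiv ℝ g ⁻¹' {0}ᶜ) :=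
    (hg.continuousOn_fderiv_of_isOpen hW₁ (by simp)).isOpen_inter_preimage hW₁
      isOpen_compl_singleton
  exact ⟨W₁ ∩ fderiv ℝ g ⁻¹' {0}ᶜ, g, ⟨haW₁, hga'⟩, hopen, hg.mono inter_subset_left,
    fun x hx => hmem₁ x hx.1, fun x hx => hx.2⟩

namespace BoundaryChart

variable {W : Set ℂ} {g : ℂ → ℝ}

lemma mem_interior (h : β.BoundaryChart W g) {x : ℂ} (hx : x ∈ W) (hpos : 0 < g x) :
    x ∈ interior β.region :=
  mem_interior_region_of_pos h.isOpen h.contDiffOn.continuousOn h.mem_iff hx hpos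

/-- A zero of `g` interior to the region would be a local minimum of `g`, against the non-vanishing
of the differential. -/
lemma mem_frontier_iff (h : β.BoundaryChart W g) {x : ℂ} (hx : x ∈ W) :
    x ∈ frontier β.region ↔ g x = 0 := by
  refine ⟨apply_eq_zero_of_mem_frontier h.isOpen h.contDiffOn.continuousOn h.mem_iff hx,
    fun h0 => ⟨subset_closure ((h.mem_iff x hx).2 h0.ge), fun hint => ?_⟩⟩
  refine h.fderiv_ne x hx (IsLocalMin.fderiv_eq_zero ?_)
  filter_upwards [mem_interior_iff_mem_nhds.1 hint, h.isOpen.mem_nhds hx] with y hy hyW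
  rw [h0]
  exact (h.mem_iff y hyW).1 hy

/-- The normal points from the centre to the contact point. If `g` increased in a direction `v` with
positive normal component, the centre could move along `v` inside the region while coming closer
than the radius to a point of the fixed body. -/
lemma fderiv_nonpos (h : β.BoundaryChart W g) (hβ : β.Regular) {x : ℂ} (hx : x ∈ W)
    (hf : x ∈ frontier β.region) {v : ℂ} (hv : 0 < dot v (β.normal x)) : fderiv ℝ g x v ≤ 0 := by
  by_contra! hpos
  obtain ⟨ε, hε, hev⟩ := eventually_strictMonoOn_line h.isOpen h.contDiffOn hx hpos
  obtain ⟨hWl, hmono⟩ := hev.self_of_nhds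
  obtain ⟨hbt, hbd⟩ := hβ.contactPoint_spec hf
  set b := β.contactPoint (1, x)
  -- The squared distance from the contact point to `x + t • v` is $R^2 - 2tR\,v\cdot n + t^2|v|^2$;
  -- the last condition puts it below $R^2$. The `+ 1` in the witness makes that inequality strict.
  obtain ⟨t, ht0, htε, htv⟩ : ∃ t : ℝ, 0 < t ∧ t ≤ ε ∧
      t * ‖v‖ ^ 2 < 2 * β.radius * dot v (β.normal x) := by
    have hk : 0 < 2 * β.radius * dot v (β.normal x) := by have := hβ.radius_pos; positivity
    refine ⟨min ε (2 * β.radius * dot v (β.normal x) / (‖v‖ ^ 2 + 1)), by positivity,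
      min_le_left _ _, ?_⟩
    calc _ ≤ 2 * β.radius * dot v (β.normal x) / (‖v‖ ^ 2 + 1) * ‖v‖ ^ 2 := by
          gcongr; exact min_le_right _ _
      _ < _ := by
          rw [div_mul_eq_mul_div, div_lt_iff₀ (by positivity)]
          nlinarith
  have hm := hmono (⟨by linarith, hε.le⟩ : (0 : ℝ) ∈ Icc (-ε) ε)
    (⟨by linarith, htε⟩ : t ∈ Icc (-ε) ε) ht0
  simp only [zero_smul, add_zero, (h.mem_frontier_iff hx).1 hf] at hm
  have hreg := (h.mem_iff _ (hWl t ⟨by linarith, htε⟩)).2 hm.le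
  have hle := le_dist_of_mem_region hreg hbt
  have hbx : b - x = β.radius • β.normal x := by
    rw [normal_eq, smul_inv_smul₀ hβ.radius_pos.ne']
  have hsq : dist b (x + t • v) ^ 2
      = β.radius ^ 2 - 2 * t * β.radius * dot v (β.normal x) + t ^ 2 * ‖v‖ ^ 2 := by
    have e : b - (x + t • v) = β.radius • β.normal x - t • v := by rw [← hbx]; ring
    rw [dist_eq_norm, e, ← dot_self, ← dot_self]
    have := hβ.dot_normal_self hf
    simp only [dot, Complex.sub_re, Complex.sub_im, Complex.real_smul, Complex.mul_re,
      Complex.mul_im, Complex.ofReal_re, Complex.ofReal_im] at this ⊢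
    linear_combination β.radius ^ 2 * this
  have : β.radius ^ 2 ≤ dist b (x + t • v) ^ 2 := by
    have := hβ.radius_pos; gcongr
  nlinarith

/-- A linear form that is non-positive on an open half-plane is a non-positive multiple of the inner
product with its normal. So the normal defined by contact is the normal given by the chart. -/
lemma exists_fderiv_eq (h : β.BoundaryChart W g) (hβ : β.Regular) {x : ℂ} (hx : x ∈ W)
    (hf : x ∈ frontier β.region) :
    ∃ c > 0, ∀ v, fderiv ℝ g x v = -c * dot v (β.normal x) := by
  have hn := hβ.dot_normal_self hf
  set n := β.normal x with hndef
  set ℓ := fderiv ℝ g x with hℓ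
  have hIn : dot (Complex.I * n) n = 0 := by simp [dot]; ring
  have hle : ∀ k : ℝ, ℓ n + k * ℓ (Complex.I * n) ≤ 0 := fun k => by
    have := h.fderiv_nonpos hβ hx hf (v := n + k • (Complex.I * n))
      (by rw [dot_add_left, dot_smul_left, ← hndef, hn, hIn]; norm_num)
    rwa [← hℓ, map_add, map_smul, smul_eq_mul] at this
  have htan : ℓ (Complex.I * n) = 0 := by
    by_contra hne
    -- This multiple would make the left side of `hle` equal to `1`.
    have h1 := hle ((1 - ℓ n) / ℓ (Complex.I * n))
    rw [div_mul_cancel₀ _ hne] at h1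
    linarith
  have hv : ∀ v, ℓ v = ℓ n * dot v n := fun v => by
    conv_lhs => rw [eq_dot_smul_add hn v]
    rw [map_add, map_smul, map_smul, htan, smul_zero, add_zero, smul_eq_mul, mul_comm]
  refine ⟨-ℓ n, ?_, fun v => by rw [hv v]; ring⟩
  have h0 := hle 0
  rcases (show ℓ n ≤ 0 by linarith).lt_or_eq with hlt | heq
  · linarith
  · exact (h.fderiv_ne x hx (ContinuousLinearMap.ext fun v => by
      rw [← hℓ, hv v, heq]; simp)).elim

end BoundaryChart

/-- The normal extends locally to a smooth function of the centre. -/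
lemma Regular.exists_contDiffAt_normal (hβ : β.Regular) {a : ℂ} (ha : a ∈ frontier β.region) :
    ∃ ν : ℂ → ℂ, ContDiffAt ℝ ∞ ν a ∧ ∀ᶠ x in 𝓝 a, x ∈ frontier β.region → ν x = β.normal x := by
  obtain ⟨W, g, haW, h⟩ := hβ.exists_boundaryChart ha
  -- `G` is the gradient of `g`, a negative multiple of the normal on the frontier; its normalised
  -- opposite is the smooth extension.
  set G : ℂ → ℂ := fun x => (fderiv ℝ g x 1 : ℂ) + (fderiv ℝ g x Complex.I : ℂ) * Complex.I
  have hG : ∀ x ∈ W, x ∈ frontier β.region → ∃ c > 0, G x = (-c : ℝ) • β.normal x := by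
    intro x hx hf
    obtain ⟨c, hc, hcv⟩ := h.exists_fderiv_eq hβ hx hf
    refine ⟨c, hc, ?_⟩
    apply Complex.ext <;> simp [G, hcv, dot]
  refine ⟨fun x => -(‖G x‖⁻¹ • G x), ?_, ?_⟩
  · have hfd : ContDiffAt ℝ ∞ (fderiv ℝ g) a :=
      (h.contDiffOn.contDiffAt (h.isOpen.mem_nhds haW)).fderiv_right (by simp)
    have hGs : ContDiffAt ℝ ∞ G a := by
      have e : ∀ v : ℂ, ContDiffAt ℝ ∞ (fun x => ((fderiv ℝ g x v : ℝ) : ℂ)) a := fun v =>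
        Complex.ofRealCLM.contDiff.contDiffAt.comp a (hfd.clm_apply contDiffAt_const)
      exact (e 1).add ((e Complex.I).mul contDiffAt_const)
    have hG0 : G a ≠ 0 := by
      obtain ⟨c, hc, hcv⟩ := hG a haW ha
      rw [hcv]
      refine smul_ne_zero (by linarith) fun h0 => ?_
      have := hβ.dot_normal_self ha
      rw [h0] at this; simp [dot] at this
    exact (((hGs.norm ℝ hG0).inv (by simpa using hG0)).smul hGs).neg
  · filter_upwards [h.isOpen.mem_nhds haW] with x hx hf
    obtain ⟨c, hc, hcv⟩ := hG x hx hf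
    have h1 : ‖β.normal x‖ = 1 := by
      have := hβ.dot_normal_self hf
      rw [dot_self] at this
      exact (pow_eq_one_iff_of_nonneg (norm_nonneg _) two_ne_zero).1 this
    rw [hcv, norm_smul, h1, Real.norm_eq_abs, abs_neg, abs_of_pos hc, mul_one, smul_smul,
      mul_neg, inv_mul_cancel₀ hc.ne']
    simp

end DiscBilliard

end RoughBilliard

/-! ### Free motion and the time of first return -/

namespace RoughBilliard

/-- Velocity of the centre of the disc, in the fixed frame. -/
def velocity (x : State) : ℂ := (x.1.1 : ℂ) * x.2.2

namespace DiscBilliard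

lemma freeMotion_center (t : ℝ) (x : State) : (freeMotion t x).1.2 = x.1.2 + t • velocity x := rfl

lemma velocity_freeMotion (t : ℝ) (x : State) : velocity (freeMotion t x) = velocity x := by
  have h : Complex.exp (t * x.2.1 * Complex.I) * Complex.exp (-(t * x.2.1) * Complex.I) = 1 := by
    rw [← Complex.exp_add]; simp
  simp only [velocity, freeMotion, Circle.coe_mul, Circle.coe_exp]
  push_cast
  linear_combination ((x.1.1 : ℂ) * x.2.2) * h

lemma freeMotion_freeMotion (s t : ℝ) (x : State) :
    freeMotion s (freeMotion t x) = freeMotion (s + t) x := by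
  refine Prod.ext (Prod.ext ?_ ?_) (Prod.ext rfl ?_)
  · simp only [freeMotion, add_mul, Circle.exp_add]
    rw [mul_assoc, mul_comm (Circle.exp (t * x.2.1))]
  · rw [freeMotion_center, velocity_freeMotion, freeMotion_center, freeMotion_center]
    rw [add_smul]; ring
  · simp only [freeMotion, add_mul, neg_add, Circle.exp_add, Circle.coe_mul]
    ring

lemma freeMotion_zero (x : State) : freeMotion 0 x = x := by
  simp [freeMotion]

variable {β : DiscBilliard}

lemma dot_bodyNormal (x : State) :
    dot x.2.2 (β.bodyNormal x.1) = dot (velocity x) (β.normal x.1.2) := by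
  rw [bodyNormal_eq, dot_conj_mul]; rfl

lemma mem_postCollision {E : ℝ} {x : State} : x ∈ β.postCollision E ↔
    x.1.2 ∈ frontier β.region ∧ β.energy x.2 = E ∧ dot (velocity x) (β.normal x.1.2) < 0 := by
  rw [postCollision, mem_ofPred_eq, mem_boundary, dot_bodyNormal]

/-- Positive times at which a point in rectilinear motion is on the boundary of the region. -/
def lineHits (β : DiscBilliard) (p : ℂ × ℂ) : Set ℝ :=
  {t | 0 < t ∧ p.1 + t • p.2 ∈ frontier β.region}

lemma hitTimes_eq (x : State) : β.hitTimes x = β.lineHits (x.1.2, velocity x) := by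
  ext t; simp [hitTimes, lineHits, mem_boundary, freeMotion_center]

/-- An inward velocity makes the chart function strictly increasing along the line, on a time
interval that serves for all nearby initial data. -/
lemma Regular.exists_eventually_mem_interior (hβ : β.Regular) {a w : ℂ}
    (ha : a ∈ frontier β.region) (hw : dot w (β.normal a) < 0) :
    ∃ ε > (0 : ℝ), ∀ᶠ p : ℂ × ℂ in 𝓝 (a, w), p.1 ∈ frontier β.region →
      ∀ t ∈ Ioc 0 ε, p.1 + t • p.2 ∈ interior β.region := by
  obtain ⟨W, g, haW, h⟩ := hβ.exists_boundaryChart ha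
  obtain ⟨c, hc, hcv⟩ := h.exists_fderiv_eq hβ haW ha
  obtain ⟨ε, hε, hev⟩ := eventually_strictMonoOn_line h.isOpen h.contDiffOn haW (v := w)
    (by rw [hcv]; nlinarith)
  refine ⟨ε, hε, hev.mono fun p hp hpf t ht => ?_⟩
  have h0 : (0 : ℝ) ∈ Icc (-ε) ε := ⟨by linarith, hε.le⟩
  have h1 : t ∈ Icc (-ε) ε := ⟨by linarith [ht.1], ht.2⟩
  have hpW : p.1 ∈ W := by simpa using hp.1 0 h0
  have hm := hp.2 h0 h1 ht.1
  simp only [zero_smul, add_zero, (h.mem_frontier_iff hpW).1 hpf] at hm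
  exact h.mem_interior (hp.1 t h1) hm

/-- The time of arrival at the boundary is a smooth function near a transversal arrival. -/
lemma Regular.exists_arrival_time (hβ : β.Regular) {a w : ℂ} {τ : ℝ}
    (ha : a + τ • w ∈ frontier β.region) (hw : 0 < dot w (β.normal (a + τ • w))) :
    ∃ T : ℂ × ℂ → ℝ, ContDiffAt ℝ ∞ T (a, w) ∧ T (a, w) = τ ∧ ∃ ε > 0,
      ∀ᶠ p : ℂ × ℂ in 𝓝 (a, w), p.1 + T p • p.2 ∈ frontier β.region ∧
        ∀ t ∈ Ico (τ - ε) (T p), p.1 + t • p.2 ∈ interior β.region := by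
  obtain ⟨W, g, haW, h⟩ := hβ.exists_boundaryChart ha
  obtain ⟨c, hc, hcv⟩ := h.exists_fderiv_eq hβ haW ha
  have hneg : fderiv ℝ g (a + τ • w) w < 0 := by rw [hcv]; nlinarith
  -- The arrival time solves `g (a + t • w) = 0` for `t`. The derivative in `t` is the derivative of
  -- `g` along `w`, non-zero by transversality.
  set f : (ℂ × ℂ) × ℝ → ℝ := fun y => g (y.1.1 + y.2 • y.1.2) with hf
  have hga : ContDiffAt ℝ ∞ g (a + τ • w) := h.contDiffOn.contDiffAt (h.isOpen.mem_nhds haW)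
  have hfs : ContDiffAt ℝ ∞ f ((a, w), τ) :=
    ContDiffAt.comp (f := fun y : (ℂ × ℂ) × ℝ => y.1.1 + y.2 • y.1.2) ((a, w), τ) hga
      (ContDiff.contDiffAt (by fun_prop))
  have hpart : ∀ s, (fderiv ℝ f ((a, w), τ) ∘L .inr ℝ (ℂ × ℂ) ℝ) s
      = s * fderiv ℝ g (a + τ • w) w := fun s => by
    have h1 : HasFDerivAt (fun t : ℝ => f ((a, w), t))
        (fderiv ℝ f ((a, w), τ) ∘L .inr ℝ (ℂ × ℂ) ℝ) τ :=
      HasFDerivAt.comp (f := fun t : ℝ => ((a, w), t)) τ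
        (hfs.differentiableAt (by simp)).hasFDerivAt (hasFDerivAt_prodMk_right (a, w) τ)
    have h2 : HasDerivAt (fun t : ℝ => f ((a, w), t)) (fderiv ℝ g (a + τ • w) w) τ := by
      have h3 : HasDerivAt (fun t : ℝ => a + t • w) w τ := by
        simpa using ((hasDerivAt_id τ).smul_const w).const_add a
      exact HasFDerivAt.comp_hasDerivAt τ (hga.differentiableAt (by simp)).hasFDerivAt h3
    rw [h1.unique h2.hasFDerivAt]
    simp
  have hinv : (fderiv ℝ f ((a, w), τ) ∘L .inr ℝ (ℂ × ℂ) ℝ).IsInvertible := by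
    refine ⟨ContinuousLinearEquiv.unitsEquivAut ℝ (Units.mk0 _ hneg.ne), ?_⟩
    refine ContinuousLinearMap.ext fun s => ?_
    rw [hpart]
    simp [ContinuousLinearEquiv.unitsEquivAut_apply]
  set T := hfs.implicitFunction (by simp) hinv with hT
  have hTs : ContDiffAt ℝ ∞ T (a, w) := hfs.contDiffAt_implicitFunction (by simp) hinv
  have hTa : T (a, w) = τ := hfs.implicitFunction_apply_self (by simp) hinv
  refine ⟨T, hTs, hTa, ?_⟩
  -- Since `-g` increases along all nearby lines through a window around `τ`, `g` is positive before
  -- the zero at `T p`, which places the centre in the interior.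
  have hng : 0 < fderiv ℝ (fun x => -g x) (a + τ • w) w := by
    rw [fderiv_fun_neg]; simpa using hneg
  obtain ⟨ε, hε, hev⟩ := eventually_strictMonoOn_line h.isOpen h.contDiffOn.neg haW hng
  have hshift : Continuous fun p : ℂ × ℂ => (p.1 + τ • p.2, p.2) := by fun_prop
  have hTc : Tendsto T (𝓝 (a, w)) (𝓝 τ) := by simpa [hTa] using hTs.continuousAt.tendsto
  refine ⟨ε, hε, ?_⟩
  filter_upwards [(hshift.tendsto (a, w)).eventually hev,
    hfs.eventually_apply_implicitFunction (by simp) hinv,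
    hTc.eventually (Ioo_mem_nhds (show τ - ε < τ by linarith) (show τ < τ + ε by linarith))]
    with p hp hpT hpI
  have hline : ∀ t : ℝ, p.1 + τ • p.2 + (t - τ) • p.2 = p.1 + t • p.2 := fun t => by
    rw [sub_smul]; ring
  have hTI : T p - τ ∈ Icc (-ε) ε := ⟨by linarith [hpI.1], by linarith [hpI.2]⟩
  have hTW := hp.1 _ hTI
  simp only [hline] at hTW
  have hg0 : g (p.1 + T p • p.2) = 0 := by
    have := (h.mem_frontier_iff haW).1 ha
    exact hpT.trans this
  refine ⟨(h.mem_frontier_iff hTW).2 hg0, fun t ht => ?_⟩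
  have htI : t - τ ∈ Icc (-ε) ε := ⟨by linarith [ht.1], by linarith [ht.2, hpI.2]⟩
  have htW := hp.1 _ htI
  have hm := hp.2 htI hTI (by linarith [ht.2])
  simp only [hline, hg0] at hm htW
  exact h.mem_interior htW (by linarith)

/-- Transversal departure keeps hitting times away from `0`, so the open condition `0 < t` can be
replaced by a closed one and the infimum is attained. -/
lemma Regular.isLeast_sInf_lineHits (hβ : β.Regular) {a w : ℂ}
    (ha : a ∈ frontier β.region) (hw : dot w (β.normal a) < 0)
    (hne : (β.lineHits (a, w)).Nonempty) :
    IsLeast (β.lineHits (a, w)) (sInf (β.lineHits (a, w))) := by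
  obtain ⟨ε, hε, hev⟩ := hβ.exists_eventually_mem_interior ha hw
  have hint := hev.self_of_nhds ha
  have hlow : ∀ t ∈ β.lineHits (a, w), ε ≤ t := fun t ht => by
    by_contra! hlt
    exact ht.2.2 (hint t ⟨ht.1, hlt.le⟩)
  have heq : β.lineHits (a, w) = Ici ε ∩ (fun t : ℝ => a + t • w) ⁻¹' frontier β.region := by
    ext t
    exact ⟨fun ht => ⟨hlow t ht, ht.2⟩, fun ht => ⟨hε.trans_le ht.1, ht.2⟩⟩
  have hcl : IsClosed (β.lineHits (a, w)) := by
    rw [heq]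
    exact isClosed_Ici.inter (isClosed_frontier.preimage (by fun_prop))
  exact hcl.isLeast_csInf hne ⟨ε, hlow⟩

/-- By connectedness: the open segment starts in the interior and avoids the frontier, so it cannot
reach the complement of the region. -/
lemma Regular.mem_interior_of_lt (hβ : β.Regular) {a w : ℂ} {τ : ℝ}
    (ha : a ∈ frontier β.region) (hw : dot w (β.normal a) < 0)
    (hτ : IsLeast (β.lineHits (a, w)) τ) {t : ℝ} (ht0 : 0 < t) (htτ : t < τ) :
    a + t • w ∈ interior β.region := by
  obtain ⟨ε, hε, hev⟩ := hβ.exists_eventually_mem_interior ha hw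
  have hint := hev.self_of_nhds ha
  have hpre : IsPreconnected ((fun t : ℝ => a + t • w) '' Ioo 0 τ) :=
    isPreconnected_Ioo.image _ (Continuous.continuousOn (by fun_prop))
  have hnf : ∀ s ∈ Ioo 0 τ, a + s • w ∉ frontier β.region := fun s hs hf =>
    (hτ.2 ⟨hs.1, hf⟩).not_gt hs.2
  by_contra hn
  have hmin : min t ε ∈ Ioo 0 τ := ⟨lt_min ht0 hε, (min_le_left _ _).trans_lt htτ⟩
  obtain ⟨x, -, hx, hx'⟩ := hpre (interior β.region) β.regionᶜ isOpen_interior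
    β.isClosed_region.isOpen_compl
    (by
      rintro _ ⟨s, hs, rfl⟩
      by_contra h
      rw [mem_union, not_or, notMem_compl_iff] at h
      exact hnf s hs ⟨subset_closure h.2, h.1⟩)
    ⟨_, mem_image_of_mem _ hmin, hint _ ⟨hmin.1, min_le_right _ _⟩⟩
    ⟨_, mem_image_of_mem _ ⟨ht0, htτ⟩, fun h => hnf t ⟨ht0, htτ⟩ ⟨subset_closure h, hn⟩⟩
  exact hx' (interior_subset hx)

/-- Near a departure with transversal arrival, the time of first return is a smooth function. -/
lemma Regular.exists_return_time (hβ : β.Regular) {a w : ℂ} {τ : ℝ}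
    (ha : a ∈ frontier β.region) (hw : dot w (β.normal a) < 0)
    (hτ : IsLeast (β.lineHits (a, w)) τ) (hw' : 0 < dot w (β.normal (a + τ • w))) :
    ∃ T : ℂ × ℂ → ℝ, ContDiffAt ℝ ∞ T (a, w) ∧ T (a, w) = τ ∧
      ∀ᶠ p : ℂ × ℂ in 𝓝 (a, w), p.1 ∈ frontier β.region → IsLeast (β.lineHits p) (T p) := by
  obtain ⟨T, hTs, hTa, ε, hε, hev⟩ := hβ.exists_arrival_time hτ.1.2 hw'
  obtain ⟨δ, hδ, hev'⟩ := hβ.exists_eventually_mem_interior ha hw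
  refine ⟨T, hTs, hTa, ?_⟩
  -- Between the departure and arrival windows, compactness of the time interval gives a
  -- neighbourhood independent of `t`. The interval may be empty, which is harmless.
  have hmid : ∀ᶠ p : ℂ × ℂ in 𝓝 (a, w), ∀ t ∈ Icc δ (τ - ε),
      p.1 + t • p.2 ∈ interior β.region := by
    refine isCompact_Icc.eventually_forall_of_forall_eventually fun t ht => ?_
    have hc : Continuous fun y : (ℂ × ℂ) × ℝ => y.1.1 + y.2 • y.1.2 := by fun_prop
    exact (hc.tendsto ((a, w), t)).eventually (isOpen_interior.mem_nhds
      (hβ.mem_interior_of_lt ha hw hτ (hδ.trans_le ht.1) (by linarith [ht.2])))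
  have hTpos : ∀ᶠ p in 𝓝 (a, w), 0 < T p :=
    hTs.continuousAt.eventually (lt_mem_nhds (by rw [hTa]; exact hτ.1.1))
  filter_upwards [hev, hev', hmid, hTpos] with p h1 h2 h3 h4 hpf
  refine ⟨⟨h4, h1.1⟩, fun t ht => ?_⟩
  by_contra! hlt
  refine ht.2.2 ?_
  rcases le_or_gt t δ with htδ | htδ
  · exact h2 hpf t ⟨ht.1, htδ⟩
  · rcases le_or_gt t (τ - ε) with hte | hte
    · exact h3 t ⟨htδ.le, hte⟩
    · exact h1.2 t ⟨hte.le, hlt⟩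

end DiscBilliard

end RoughBilliard

/-! ### Algebra of the rough collision -/

namespace RoughBilliard

lemma star_mul_self_circle (A : Circle) : star (A : ℂ) * (A : ℂ) = 1 := by
  rw [Complex.star_def, mul_comm, Complex.mul_conj]; simp

lemma hasDerivAt_re {f : ℝ → ℂ} {f' : ℂ} {t : ℝ} (hf : HasDerivAt f f' t) :
    HasDerivAt (fun s => (f s).re) f'.re t :=
  Complex.reCLM.hasFDerivAt.comp_hasDerivAt t hf

lemma hasDerivAt_im {f : ℝ → ℂ} {f' : ℂ} {t : ℝ} (hf : HasDerivAt f f' t) :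
    HasDerivAt (fun s => (f s).im) f'.im t :=
  Complex.imCLM.hasFDerivAt.comp_hasDerivAt t hf

lemma hasDerivAt_dot {f g : ℝ → ℂ} {f' g' : ℂ} {t : ℝ} (hf : HasDerivAt f f' t)
    (hg : HasDerivAt g g' t) :
    HasDerivAt (fun s => dot (f s) (g s)) (dot f' (g t) + dot (f t) g') t := by
  have := ((hasDerivAt_re hf).mul (hasDerivAt_re hg)).add
    ((hasDerivAt_im hf).mul (hasDerivAt_im hg))
  exact this.congr_deriv (by simp only [dot]; ring)

lemma hasDerivAt_star {f : ℝ → ℂ} {f' : ℂ} {t : ℝ} (hf : HasDerivAt f f' t) :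
    HasDerivAt (fun s => star (f s)) (star f') t :=
  Complex.conjCLE.toContinuousLinearMap.hasFDerivAt.comp_hasDerivAt t hf

lemma dot_I_mul_I_mul (u w : ℂ) : dot (Complex.I * u) (Complex.I * w) = dot u w := by
  simp [dot]; ring

namespace DiscBilliard

/-- Reversal of the velocity. -/
def reverse (x : State) : State := (x.1, -x.2)

lemma velocity_reverse (x : State) : velocity (reverse x) = -velocity x := by
  simp [velocity, reverse]

variable (β : DiscBilliard)

/-- Change of the state in a completely rough collision. -/
def collide (x : State) : State := (x.1, β.roughCollision x.1 x.2)

/-- Tangential velocity of the contact point. -/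
def slip (x : State) : ℝ :=
  β.radius * x.2.1 + dot (velocity x) (Complex.I * β.normal x.1.2)

/-- The factor `1 / (1 + R² / (2 λ))` of the collision map. -/
def collisionFactor : ℝ := 1 / (1 + β.radius ^ 2 / (2 * β.inertia))

variable {β}

lemma dot_bodyNormal_self (hβ : β.Regular) {q : Config} (hq : q.2 ∈ frontier β.region) :
    dot (β.bodyNormal q) (β.bodyNormal q) = 1 := by
  rw [bodyNormal_eq, dot_conj_mul, ← mul_assoc, mul_comm (q.1 : ℂ), star_mul_self_circle, one_mul,
    hβ.dot_normal_self hq]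

lemma tangential_pointVelocity (hβ : β.Regular) {x : State} (hx : x.1.2 ∈ frontier β.region) :
    pointVelocity x.2 (β.bodyContact x.1)
        - dot (pointVelocity x.2 (β.bodyContact x.1)) (β.bodyNormal x.1) • β.bodyNormal x.1
      = β.slip x • (Complex.I * β.bodyNormal x.1) := by
  have hn := dot_bodyNormal_self hβ hx
  have h1 : dot x.2.2 (Complex.I * β.bodyNormal x.1)
      = dot (velocity x) (Complex.I * β.normal x.1.2) := by
    rw [bodyNormal_eq, mul_left_comm, dot_conj_mul]; rfl
  have h2 : pointVelocity x.2 (β.bodyContact x.1)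
      = (β.radius * x.2.1) • (Complex.I * β.bodyNormal x.1) + x.2.2 := by
    rw [pointVelocity, hβ.bodyContact_eq]; simp; ring
  rw [sub_eq_iff_eq_add', slip, ← h1]
  conv_lhs => rw [eq_dot_smul_add hn (pointVelocity x.2 (β.bodyContact x.1))]
  congr 2
  rw [h2, dot_add_left, dot_smul_left, dot_I_mul_I_mul, hn, mul_one]

/-- With $\mathcal T=-I$ one has $(I-\mathcal T)V = 2V$, where $V$ is the slip times the unit
tangent, and $b_\circ\wedge(\text{unit tangent}) = R$. -/
lemma collide_snd (hβ : β.Regular) {x : State} (hx : x.1.2 ∈ frontier β.region) :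
    (β.collide x).2 = (x.2.1 - β.collisionFactor / (2 * β.inertia) * (2 * β.radius * β.slip x),
      x.2.2 - (2 * β.collisionFactor * β.slip x) • (Complex.I * β.bodyNormal x.1)
        - (2 * dot x.2.2 (β.bodyNormal x.1)) • β.bodyNormal x.1) := by
  have hn := dot_bodyNormal_self hβ hx
  simp only [collide, roughCollision, collisionMap, tangential_pointVelocity hβ hx]
  refine Prod.ext ?_ ?_
  · simp only [← collisionFactor.eq_1 β]
    congr 2
    rw [hβ.bodyContact_eq]
    simp only [wedge, dot, LinearMap.neg_apply, LinearMap.id_apply, Complex.real_smul,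
      Complex.sub_re, Complex.sub_im, Complex.neg_re, Complex.neg_im, Complex.mul_re,
      Complex.mul_im, Complex.ofReal_re, Complex.ofReal_im, Complex.I_re, Complex.I_im] at hn ⊢
    linear_combination (2 * β.radius * β.slip x) * hn
  · simp only [← collisionFactor.eq_1 β]
    simp
    ring

lemma collide_spin (hβ : β.Regular) {x : State} (hx : x.1.2 ∈ frontier β.region) :
    (β.collide x).2.1
      = x.2.1 - β.collisionFactor / (2 * β.inertia) * (2 * β.radius * β.slip x) := by
  rw [collide_snd hβ hx]

lemma velocity_collide (hβ : β.Regular) {x : State} (hx : x.1.2 ∈ frontier β.region) :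
    velocity (β.collide x) = velocity x
      - (2 * β.collisionFactor * β.slip x) • (Complex.I * β.normal x.1.2)
      - (2 * dot (velocity x) (β.normal x.1.2)) • β.normal x.1.2 := by
  have hA : (x.1.1 : ℂ) * β.bodyNormal x.1 = β.normal x.1.2 := by
    rw [bodyNormal_eq, ← mul_assoc, mul_comm (x.1.1 : ℂ), star_mul_self_circle, one_mul]
  rw [velocity, collide_snd hβ hx, ← dot_bodyNormal, velocity]
  simp only [Complex.real_smul, collide]
  linear_combination (-(2 * β.collisionFactor * β.slip x : ℝ) * Complex.I
    - (2 * dot x.2.2 (β.bodyNormal x.1) : ℝ)) * hA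

lemma Regular.mass_pos (hβ : β.Regular) : 0 < β.mass := by
  have := hβ.mass_finite
  refine ENNReal.toReal_pos (fun h => hβ.mass_nondeg ?_) (measure_ne_top _ _)
  exact measure_mono_null (subset_univ _) h

/-- A vanishing second moment puts all the mass on the imaginary axis, by symmetry also on the real
axis, hence at the centre, which is excluded. -/
lemma Regular.inertia_pos (hβ : β.Regular) : 0 < β.inertia := by
  have := hβ.mass_finite
  refine div_pos (lt_of_le_of_ne (integral_nonneg fun b => sq_nonneg _) fun h0 => ?_) hβ.mass_pos
  have hdisc : ∀ᵐ b ∂β.massDist, b ∈ β.disc := by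
    rw [ae_iff]; exact hβ.mass_carried
  have hint : Integrable (fun b : ℂ => b.re ^ 2) β.massDist := by
    refine Integrable.of_bound (Continuous.aestronglyMeasurable (by fun_prop)) (β.radius ^ 2) ?_
    filter_upwards [hdisc] with b hb
    have hb' : ‖b‖ ≤ β.radius := by simpa [disc] using hb
    rw [Real.norm_of_nonneg (sq_nonneg _), ← sq_abs]
    gcongr
    exact (Complex.abs_re_le_norm b).trans hb'
  have hre : ∀ᵐ b ∂β.massDist, b.re = 0 := by
    filter_upwards [(integral_eq_zero_iff_of_nonneg (fun b : ℂ => sq_nonneg b.re) hint).1 h0.symm]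
      with b hb
    simpa using hb
  have him : ∀ᵐ b ∂β.massDist, b.im = 0 := by
    -- A quarter turn exchanges the two coordinates up to sign.
    have h1 := hβ.mass_symm ⟨Complex.I, by simp [Submonoid.unitSphere]⟩
    rw [← h1] at hre
    have h2 := ae_of_ae_map (Continuous.aemeasurable (by fun_prop)) hre
    filter_upwards [h2] with b hb
    simpa using hb
  refine hβ.mass_nondeg (mem_ae_iff.1 ?_)
  filter_upwards [hre, him] with b h1 h2
  exact Complex.ext h1 h2

/-- The only property of $\alpha$ behind the reversal of the slip, the conservation of energy and
the determinant $-1$. -/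
lemma Regular.collisionFactor_spec (hβ : β.Regular) :
    β.collisionFactor * (2 * β.inertia + β.radius ^ 2) = 2 * β.inertia := by
  have := hβ.inertia_pos
  have := hβ.radius_pos
  rw [collisionFactor]
  field_simp

lemma energy_eq (x : State) :
    β.energy x.2 = β.mass * (2 * β.inertia * x.2.1 ^ 2 + dot (velocity x) (velocity x)) / 2 := by
  have : dot (velocity x) (velocity x) = dot x.2.2 x.2.2 := by
    rw [dot_self, dot_self, velocity, norm_mul, Circle.norm_coe, one_mul]
  rw [this, energy, metric]; ring

lemma dot_I_mul_self (n : ℂ) : dot n (Complex.I * n) = 0 := by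
  simp [dot]; ring

lemma dot_velocity_collide (hβ : β.Regular) {x : State} (hx : x.1.2 ∈ frontier β.region) :
    dot (velocity (β.collide x)) (β.normal x.1.2) = -dot (velocity x) (β.normal x.1.2) := by
  have hn := hβ.dot_normal_self hx
  rw [velocity_collide hβ hx, sub_eq_add_neg, sub_eq_add_neg, dot_add_left, dot_add_left,
    dot_neg_left, dot_neg_left, dot_smul_left, dot_smul_left, hn, dot_comm (Complex.I * _),
    dot_I_mul_self]
  ring

lemma dot_velocity_collide_tangent (hβ : β.Regular) {x : State}
    (hx : x.1.2 ∈ frontier β.region) :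
    dot (velocity (β.collide x)) (Complex.I * β.normal x.1.2)
      = dot (velocity x) (Complex.I * β.normal x.1.2) - 2 * β.collisionFactor * β.slip x := by
  have hn := hβ.dot_normal_self hx
  rw [velocity_collide hβ hx, sub_eq_add_neg, sub_eq_add_neg, dot_add_left, dot_add_left,
    dot_neg_left, dot_neg_left, dot_smul_left, dot_smul_left, dot_I_mul_I_mul, hn,
    dot_I_mul_self]
  ring

lemma slip_collide (hβ : β.Regular) {x : State} (hx : x.1.2 ∈ frontier β.region) :
    β.slip (β.collide x) = -β.slip x := by
  have h := hβ.collisionFactor_spec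
  have hl := hβ.inertia_pos
  have e : β.slip (β.collide x) = β.radius * (β.collide x).2.1 +
    dot (velocity (β.collide x)) (Complex.I * β.normal x.1.2) := rfl
  rw [e, dot_velocity_collide_tangent hβ hx, collide_spin hβ hx]
  rw [show β.slip x = β.radius * x.2.1 + dot (velocity x) (Complex.I * β.normal x.1.2) from rfl]
  field_simp
  linear_combination (-(β.radius * x.2.1 + dot (velocity x) (Complex.I * β.normal x.1.2))) * h

/-- Two states with the same configuration, spin and velocity of the centre are equal. -/
lemma state_ext {x y : State} (h1 : x.1 = y.1) (h2 : x.2.1 = y.2.1)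
    (h3 : velocity x = velocity y) : x = y := by
  refine Prod.ext h1 (Prod.ext h2 ?_)
  rw [velocity, velocity, h1] at h3
  exact mul_left_cancel₀ (Circle.coe_ne_zero _) h3

/-- The corrections to spin and velocity are linear in the slip and the normal speed. A collision
negates both, so the second correction undoes the first. -/
lemma collide_collide (hβ : β.Regular) {x : State} (hx : x.1.2 ∈ frontier β.region) :
    β.collide (β.collide x) = x := by
  have hx' : (β.collide x).1.2 ∈ frontier β.region := hx
  refine state_ext rfl ?_ ?_
  · rw [collide_spin hβ hx', slip_collide hβ hx, collide_spin hβ hx]; ring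
  · have e : β.normal (β.collide x).1.2 = β.normal x.1.2 := rfl
    rw [velocity_collide hβ hx', slip_collide hβ hx, e, dot_velocity_collide hβ hx,
      velocity_collide hβ hx]
    simp only [mul_neg, neg_smul]
    abel

lemma energy_collide (hβ : β.Regular) {x : State} (hx : x.1.2 ∈ frontier β.region) :
    β.energy (β.collide x).2 = β.energy x.2 := by
  have h := hβ.collisionFactor_spec
  have hl := hβ.inertia_pos
  have hn := hβ.dot_normal_self hx
  have hsq : ∀ w : ℂ, dot w w
      = dot w (β.normal x.1.2) ^ 2 + dot w (Complex.I * β.normal x.1.2) ^ 2 := fun w => by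
    conv_lhs => enter [1]; rw [eq_dot_smul_add hn w]
    rw [dot_add_left, dot_smul_left, dot_smul_left, dot_comm _ w, dot_comm _ w]; ring
  rw [energy_eq, energy_eq, hsq (velocity x), hsq (velocity (β.collide x)),
    dot_velocity_collide hβ hx, dot_velocity_collide_tangent hβ hx, collide_spin hβ hx]
  rw [show β.slip x = β.radius * x.2.1 + dot (velocity x) (Complex.I * β.normal x.1.2) from rfl]
  field_simp
  set s := β.radius * x.2.1 + dot (velocity x) (Complex.I * β.normal x.1.2)
  linear_combination (2 * β.mass * β.collisionFactor * s ^ 2) * h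

end DiscBilliard

end RoughBilliard

/-! ### The form `Ω` in fixed-frame coordinates and its invariance -/

namespace RoughBilliard

namespace DiscBilliard

/-- The tangent vector at `x` with angular velocity `dφ`, velocity of the centre `da`, derivative
of the spin `ds` and derivative of the velocity (in the fixed frame) `dw`. -/
def tangentVector (x : State) (dφ : ℝ) (da : ℂ) (ds : ℝ) (dw : ℂ) : Ambient :=
  ((dφ * (Complex.I * x.1.1), da), (ds, star (x.1.1 : ℂ) * (dw - dφ * (Complex.I * velocity x))))

/-- Derivative at time `0` of a curve of states, in terms of the angle, the centre, the spin and
the velocity in the fixed frame. -/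
structure HasCoordDeriv (c : ℝ → State) (dφ : ℝ) (da : ℂ) (ds : ℝ) (dw : ℂ) : Prop where
  angle : HasDerivAt (fun t => ((c t).1.1 : ℂ)) (dφ * (Complex.I * (c 0).1.1)) 0
  center : HasDerivAt (fun t => (c t).1.2) da 0
  spin : HasDerivAt (fun t => (c t).2.1) ds 0
  vel : HasDerivAt (fun t => velocity (c t)) dw 0

lemma star_mul_velocity (x : State) : star (x.1.1 : ℂ) * velocity x = x.2.2 := by
  rw [velocity, ← mul_assoc, star_mul_self_circle, one_mul]

/-- The body-frame velocity is `star A` times the fixed-frame one; the product rule produces the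
rotation term of `tangentVector`. -/
lemma HasCoordDeriv.hasDerivAt_embed {c : ℝ → State} {dφ ds : ℝ} {da dw : ℂ}
    (h : HasCoordDeriv c dφ da ds dw) :
    HasDerivAt (fun t => embed (c t)) (tangentVector (c 0) dφ da ds dw) 0 := by
  have hz : HasDerivAt (fun t => (c t).2.2)
      (star ((c 0).1.1 : ℂ) * (dw - dφ * (Complex.I * velocity (c 0)))) 0 := by
    have h1 := (hasDerivAt_star h.angle).mul h.vel
    simp only [Pi.mul_def, star_mul_velocity] at h1
    refine h1.congr_deriv ?_
    simp; ring
  exact (h.angle.prodMk h.center).prodMk (h.spin.prodMk hz)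

lemma exists_hasCoordDeriv {c : ℝ → State} (h : DifferentiableAt ℝ (fun t => embed (c t)) 0) :
    ∃ dφ da ds dw, HasCoordDeriv c dφ da ds dw := by
  have hA : DifferentiableAt ℝ (fun t => ((c t).1.1 : ℂ)) 0 := h.fst.fst
  have ha : DifferentiableAt ℝ (fun t => (c t).1.2) 0 := h.fst.snd
  have hs : DifferentiableAt ℝ (fun t => (c t).2.1) 0 := h.snd.fst
  have hz : DifferentiableAt ℝ (fun t => (c t).2.2) 0 := h.snd.snd
  refine ⟨(star ((c 0).1.1 : ℂ) * deriv (fun t => ((c t).1.1 : ℂ)) 0).im, _, _, _, ?_,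
    ha.hasDerivAt, hs.hasDerivAt, (hA.mul hz).hasDerivAt⟩
  refine hA.hasDerivAt.congr_deriv ?_
  set A' := deriv (fun t => ((c t).1.1 : ℂ)) 0
  -- Differentiating $|A|^2=1$ shows that `star A * A'` is purely imaginary, so its imaginary part
  -- determines `A'`.
  have h1 : HasDerivAt (fun _ : ℝ => (1 : ℝ))
      (dot A' ((c 0).1.1 : ℂ) + dot ((c 0).1.1 : ℂ) A') 0 := by
    refine (hasDerivAt_dot hA.hasDerivAt hA.hasDerivAt).congr_of_eventuallyEq
      (Eventually.of_forall fun t => ?_)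
    simp only [dot_self, Circle.norm_coe]; norm_num
  have h2 := h1.unique (hasDerivAt_const _ _)
  have hB := star_mul_self_circle (c 0).1.1
  set A : ℂ := ((c 0).1.1 : ℂ)
  have hre : (star A * A').re = 0 := by
    simp [dot] at h2 ⊢; linarith
  have e : ((star A * A').im : ℂ) * Complex.I = star A * A' := by
    apply Complex.ext
    · simpa using hre.symm
    · simp
  linear_combination (-A) * e - A' * hB

variable (β : DiscBilliard)

lemma differentiable_contactForm (Y : Ambient) :
    Differentiable ℝ fun y => β.contactForm y Y := by
  have h1 : Differentiable ℝ fun y : Ambient => y.1.1.re :=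
    Complex.reCLM.differentiable.comp (differentiable_fst.comp differentiable_fst)
  have h2 : Differentiable ℝ fun y : Ambient => y.1.1.im :=
    Complex.imCLM.differentiable.comp (differentiable_fst.comp differentiable_fst)
  have h3 : Differentiable ℝ fun y : Ambient => y.2.2.re :=
    Complex.reCLM.differentiable.comp (differentiable_snd.comp differentiable_snd)
  have h4 : Differentiable ℝ fun y : Ambient => y.2.2.im :=
    Complex.imCLM.differentiable.comp (differentiable_snd.comp differentiable_snd)
  simp only [contactForm, metric, dot, Complex.star_def, Complex.mul_re, Complex.mul_im,
    Complex.conj_re, Complex.conj_im]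
  fun_prop

lemma fderiv_contactForm (x X Y : Ambient) :
    fderiv ℝ (fun y => β.contactForm y Y) x X
      = β.metric X.2 ((star x.1.1 * Y.1.1).im, star x.1.1 * Y.1.2)
        + β.metric x.2 ((star X.1.1 * Y.1.1).im, star X.1.1 * Y.1.2) := by
  have hl : HasDerivAt (fun t : ℝ => x + t • X) X 0 := by
    simpa using ((hasDerivAt_id (0 : ℝ)).smul_const X).const_add x
  have h1 : HasDerivAt (fun t : ℝ => β.contactForm (x + t • X) Y)
      (fderiv ℝ (fun y => β.contactForm y Y) x X) 0 := by
    have hF : HasFDerivAt (fun y => β.contactForm y Y)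
        (fderiv ℝ (fun y => β.contactForm y Y) x) (x + (0 : ℝ) • X) := by
      simpa using (β.differentiable_contactForm Y x).hasFDerivAt
    exact hF.comp_hasDerivAt 0 hl
  set B := β.metric X.2 ((star x.1.1 * Y.1.1).im, star x.1.1 * Y.1.2)
        + β.metric x.2 ((star X.1.1 * Y.1.1).im, star X.1.1 * Y.1.2) with hB
  -- The contact form is quadratic in the base point, so the derivative is the coefficient of `t` in
  -- this polynomial.
  have h2 : (fun t : ℝ => β.contactForm (x + t • X) Y)
      = fun t => β.contactForm x Y + t * B + t ^ 2 * β.contactForm X Y := by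
    funext t
    simp only [hB, contactForm, metric, dot, Complex.star_def, Complex.mul_re, Complex.mul_im,
      Complex.conj_re, Complex.conj_im, Prod.fst_add, Prod.snd_add, Prod.smul_fst, Prod.smul_snd,
      Complex.add_re, Complex.add_im, Complex.real_smul, Complex.ofReal_re, Complex.ofReal_im,
      smul_eq_mul]
    ring
  rw [h2] at h1
  refine h1.unique ?_
  have h3 := (((hasDerivAt_id (0 : ℝ)).mul_const B).const_add (β.contactForm x Y)).add
    ((hasDerivAt_pow 2 (0 : ℝ)).mul_const (β.contactForm X Y))
  exact h3.congr_deriv (by simp)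

/-- The symplectic form in terms of angle, centre, spin and velocity in the fixed frame. -/
def coordForm (dφ : Fin 4 → ℝ) (da : Fin 4 → ℂ) (ds : Fin 4 → ℝ) (dw : Fin 4 → ℂ)
    (i j : Fin 4) : ℝ :=
  β.mass * (2 * β.inertia * (ds i * dφ j - ds j * dφ i) + dot (dw i) (da j) - dot (dw j) (da i))

/-- The rotation of the frame contributes twice: through the derivative of `star A` in the contact
form and through the correction in `tangentVector`. The two contributions to the translational part
cancel; the angular one is the imaginary part of a real number. -/
lemma symplecticForm_tangentVector (x : State) (dφ : Fin 4 → ℝ) (da : Fin 4 → ℂ)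
    (ds : Fin 4 → ℝ) (dw : Fin 4 → ℂ) (i j : Fin 4) :
    β.symplecticForm (embed x) (tangentVector x (dφ i) (da i) (ds i) (dw i))
      (tangentVector x (dφ j) (da j) (ds j) (dw j)) = β.coordForm dφ da ds dw i j := by
  have hA := star_mul_self_circle x.1.1
  have hA' : (x.1.1 : ℂ) * star (x.1.1 : ℂ) = 1 := by rw [mul_comm, hA]
  have key : ∀ k l : Fin 4,
      fderiv ℝ (fun y => β.contactForm y (tangentVector x (dφ l) (da l) (ds l) (dw l))) (embed x)
        (tangentVector x (dφ k) (da k) (ds k) (dw k))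
      = β.mass * (2 * β.inertia * (ds k * dφ l) + dot (dw k) (da l)) := by
    intro k l
    rw [fderiv_contactForm]
    have e1 : (star (x.1.1 : ℂ) * (dφ l * (Complex.I * x.1.1))) = dφ l * Complex.I := by
      linear_combination (dφ l * Complex.I) * hA
    have e2 : (star (dφ k * (Complex.I * x.1.1) : ℂ) * (dφ l * (Complex.I * x.1.1)))
        = (dφ k * dφ l : ℝ) := by
      simp only [Complex.star_def, map_mul, Complex.conj_ofReal, Complex.conj_I]
      push_cast
      rw [Complex.star_def] at hA
      linear_combination (dφ k * dφ l) * hA - (dφ k * dφ l * (starRingEnd ℂ) x.1.1 * x.1.1) *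
        Complex.I_sq
    have e3 : (x.1.1 : ℂ) * (star (x.1.1 : ℂ) * (dw k - dφ k * (Complex.I * velocity x)))
        = dw k - dφ k * (Complex.I * velocity x) := by
      linear_combination (dw k - dφ k * (Complex.I * velocity x)) * hA'
    simp only [embed, tangentVector, metric, e1, e2, dot_conj_mul, e3]
    simp only [velocity]
    simp [dot]
    ring
  rw [symplecticForm, key i j, key j i, coordForm]
  ring

/-- The square of a two-form in dimension four. -/
def wedgeSquare (σ : Fin 4 → Fin 4 → ℝ) : ℝ :=
  2 * (σ 0 1 * σ 2 3 - σ 0 2 * σ 1 3 + σ 0 3 * σ 1 2)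

/-- The density `|Φ^* Ω|` for a smooth map `Φ` to the space of states. -/
def pullbackDensity (Φ : (Fin 4 → ℝ) → State) (u : Fin 4 → ℝ) : ℝ :=
  |β.liouvilleForm (embed (Φ u))
    (fun i => fderiv ℝ (fun w => embed (Φ w)) u (Pi.single i 1))|

/-- The restriction of `Φ` to the `i`-th coordinate line through `u`. -/
def coordLine (Φ : (Fin 4 → ℝ) → State) (u : Fin 4 → ℝ) (i : Fin 4) (t : ℝ) : State :=
  Φ (u + t • Pi.single i 1)

lemma coordLine_zero (Φ : (Fin 4 → ℝ) → State) (u : Fin 4 → ℝ) (i : Fin 4) :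
    coordLine Φ u i 0 = Φ u := by simp [coordLine]

lemma hasDerivAt_coordLine (u : Fin 4 → ℝ) (i : Fin 4) :
    HasDerivAt (fun t : ℝ => u + t • (Pi.single i 1 : Fin 4 → ℝ)) (Pi.single i 1) 0 := by
  simpa using ((hasDerivAt_id (0 : ℝ)).smul_const (Pi.single i 1 : Fin 4 → ℝ)).const_add u

lemma tendsto_coordLine (u : Fin 4 → ℝ) (i : Fin 4) :
    Tendsto (fun t : ℝ => u + t • (Pi.single i 1 : Fin 4 → ℝ)) (𝓝 0) (𝓝 u) := by
  simpa using (hasDerivAt_coordLine u i).continuousAt.tendsto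

lemma hasDerivAt_comp_coordLine {F : Type*} [NormedAddCommGroup F] [NormedSpace ℝ F]
    {f : (Fin 4 → ℝ) → F} {u : Fin 4 → ℝ} (hf : DifferentiableAt ℝ f u) (i : Fin 4) :
    HasDerivAt (fun t : ℝ => f (u + t • Pi.single i 1)) (fderiv ℝ f u (Pi.single i 1)) 0 := by
  refine HasFDerivAt.comp_hasDerivAt (f := fun t : ℝ => u + t • (Pi.single i 1 : Fin 4 → ℝ)) 0 ?_
    (hasDerivAt_coordLine u i)
  simpa using hf.hasFDerivAt

variable {β}

lemma pullbackDensity_eq {Φ : (Fin 4 → ℝ) → State} {u : Fin 4 → ℝ}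
    (hΦ : DifferentiableAt ℝ (fun v => embed (Φ v)) u) {dφ : Fin 4 → ℝ} {da : Fin 4 → ℂ}
    {ds : Fin 4 → ℝ} {dw : Fin 4 → ℂ}
    (h : ∀ i, HasCoordDeriv (coordLine Φ u i) (dφ i) (da i) (ds i) (dw i)) :
    β.pullbackDensity Φ u = |wedgeSquare (β.coordForm dφ da ds dw)| := by
  have e : ∀ i, fderiv ℝ (fun w => embed (Φ w)) u (Pi.single i 1)
      = tangentVector (Φ u) (dφ i) (da i) (ds i) (dw i) := fun i => by
    have := (h i).hasDerivAt_embed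
    rw [coordLine_zero] at this
    exact (hasDerivAt_comp_coordLine hΦ i).unique this
  simp only [pullbackDensity, liouvilleForm, e, symplecticForm_tangentVector, wedgeSquare]

lemma exists_coordDeriv {Φ : (Fin 4 → ℝ) → State} {u : Fin 4 → ℝ}
    (hΦ : DifferentiableAt ℝ (fun v => embed (Φ v)) u) :
    ∃ (dφ : Fin 4 → ℝ) (da : Fin 4 → ℂ) (ds : Fin 4 → ℝ) (dw : Fin 4 → ℂ),
      ∀ i, HasCoordDeriv (coordLine Φ u i) (dφ i) (da i) (ds i) (dw i) := by
  have := fun i => exists_hasCoordDeriv (c := coordLine Φ u i)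
    (hasDerivAt_comp_coordLine hΦ i).differentiableAt
  choose dφ da ds dw h using this
  exact ⟨dφ, da, ds, dw, h⟩

/-- Reversal negates `ds` and `dw`, hence the two-form, and leaves its square unchanged. -/
lemma pullbackDensity_reverse {Φ : (Fin 4 → ℝ) → State} {u : Fin 4 → ℝ}
    (hΦ : DifferentiableAt ℝ (fun v => embed (Φ v)) u)
    (hΦ' : DifferentiableAt ℝ (fun v => embed (reverse (Φ v))) u) :
    β.pullbackDensity (fun v => reverse (Φ v)) u = β.pullbackDensity Φ u := by
  obtain ⟨dφ, da, ds, dw, h⟩ := exists_coordDeriv hΦ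
  have h' : ∀ i, HasCoordDeriv (coordLine (fun v => reverse (Φ v)) u i)
      (dφ i) (da i) (-ds i) (-dw i) := fun i =>
    ⟨(h i).angle, (h i).center, (h i).spin.neg, by
      simpa only [coordLine, velocity_reverse] using (h i).vel.fun_neg⟩
  rw [pullbackDensity_eq hΦ h, pullbackDensity_eq hΦ' h']
  congr 1
  simp only [wedgeSquare, coordForm, dot_neg_left]
  ring

/-- Free motion during a variable time preserves the form `Ω` on an energy level. -/
lemma pullbackDensity_freeMotion {Φ : (Fin 4 → ℝ) → State} {τ : (Fin 4 → ℝ) → ℝ}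
    {u : Fin 4 → ℝ} {E : ℝ} (hΦ : DifferentiableAt ℝ (fun v => embed (Φ v)) u)
    (hΦ' : DifferentiableAt ℝ (fun v => embed (freeMotion (τ v) (Φ v))) u)
    (hτ : DifferentiableAt ℝ τ u) (hE : ∀ᶠ v in 𝓝 u, β.energy (Φ v).2 = E) :
    β.pullbackDensity (fun v => freeMotion (τ v) (Φ v)) u = β.pullbackDensity Φ u := by
  obtain ⟨dφ, da, ds, dw, h⟩ := exists_coordDeriv hΦ
  set dτ : Fin 4 → ℝ := fun i => fderiv ℝ τ u (Pi.single i 1) with hdτ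
  have hτi : ∀ i, HasDerivAt (fun t : ℝ => τ (u + t • Pi.single i 1)) (dτ i) 0 :=
    hasDerivAt_comp_coordLine hτ
  have h' : ∀ i, HasCoordDeriv (coordLine (fun v => freeMotion (τ v) (Φ v)) u i)
      (dφ i + dτ i * (Φ u).2.1 + τ u * ds i) (da i + (dτ i • velocity (Φ u) + τ u • dw i))
      (ds i) (dw i) := fun i => by
    have hz : τ (u + (0 : ℝ) • Pi.single i 1) = τ u := by simp
    have hΦz : coordLine Φ u i 0 = Φ u := coordLine_zero Φ u i
    refine ⟨?_, ?_, (h i).spin, ?_⟩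
    · have h1 := ((hτi i).mul (h i).spin).ofReal_comp.mul_const Complex.I
      have h2 := (h i).angle.mul h1.cexp
      simp only [Pi.mul_def, hΦz, hz] at h2
      simp only [coordLine, freeMotion, Circle.coe_mul, Circle.coe_exp, zero_smul, add_zero]
      refine h2.congr_deriv ?_
      push_cast
      ring
    · have h1 := (h i).center.add ((hτi i).smul (h i).vel)
      simp only [hΦz, hz] at h1
      exact h1.congr_deriv (by abel)
    · simpa only [coordLine, velocity_freeMotion] using (h i).vel
  -- The differential of the energy vanishes along the parametrised piece, which lies in one energy
  -- level.
  have hen : ∀ i, β.mass * (2 * β.inertia * ((Φ u).2.1 * ds i)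
      + dot (dw i) (velocity (Φ u))) = 0 := fun i => by
    have h1 := (((((h i).spin.pow 2).const_mul (2 * β.inertia)).add
      (hasDerivAt_dot (h i).vel (h i).vel)).const_mul β.mass).div_const 2
    have h2 : HasDerivAt (fun _ : ℝ => E) _ 0 := h1.congr_of_eventuallyEq (by
      filter_upwards [(tendsto_coordLine u i).eventually hE] with t ht
      rw [← ht, energy_eq]; rfl)
    have h3 := h2.unique (hasDerivAt_const _ _)
    simp only [coordLine_zero] at h3
    rw [dot_comm (velocity (Φ u))] at h3
    norm_num at h3
    rcases h3 with h3 | h3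
    · rw [h3]; ring
    · have : 2 * β.inertia * ((Φ u).2.1 * ds i) + dot (dw i) (velocity (Φ u)) = 0 := by linarith
      rw [this, mul_zero]
  rw [pullbackDensity_eq hΦ h, pullbackDensity_eq hΦ' h']
  congr 2
  ext i j
  simp only [coordForm]
  have d1 : ∀ x y z w : ℂ, ∀ r s : ℝ, dot x (y + (r • z + s • w))
      = dot x y + r * dot x z + s * dot x w := fun x y z w r s => by
    simp [dot]; ring
  rw [d1, d1, dot_comm (dw j) (dw i)]
  -- The terms with the factor `τ u` cancel by symmetry of `ds i * ds j` and `dot (dw i) (dw j)`;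
  -- what remains is $dE\wedge d\tau$.
  linear_combination dτ j * hen i - dτ i * hen j

/-- The square of $l\,p\wedge q + r\wedge s$ is a multiple of $p\wedge q\wedge r\wedge s$. A linear
change of $(p,r)$ multiplies it by the determinant, and added multiples of $s$ are killed by the
factor $s$. -/
lemma wedgeSquare_linear_change (m l a b c d k k' : ℝ) (q p r s : Fin 4 → ℝ) :
    wedgeSquare (fun i j => m * (l * ((a * p i + b * r i + k * s i) * q j
        - (a * p j + b * r j + k * s j) * q i)
      + (c * p i + d * r i + k' * s i) * s j - (c * p j + d * r j + k' * s j) * s i))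
    = (a * d - b * c) * wedgeSquare (fun i j => m * (l * (p i * q j - p j * q i)
      + r i * s j - r j * s i)) := by
  simp only [wedgeSquare]
  ring

/-- The completely rough collision preserves the form `Ω` up to sign. -/
lemma pullbackDensity_collide (hβ : β.Regular) {Φ : (Fin 4 → ℝ) → State} {u : Fin 4 → ℝ}
    (hΦ : DifferentiableAt ℝ (fun v => embed (Φ v)) u)
    (hΦ' : DifferentiableAt ℝ (fun v => embed (β.collide (Φ v))) u)
    (hb : ∀ᶠ v in 𝓝 u, (Φ v).1.2 ∈ frontier β.region) :
    β.pullbackDensity (fun v => β.collide (Φ v)) u = β.pullbackDensity Φ u := by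
  obtain ⟨dφ, da, ds, dw, h⟩ := exists_coordDeriv hΦ
  have hbu := hb.self_of_nhds
  have hb0 : ∀ i, ∀ᶠ t in 𝓝 0, (coordLine Φ u i t).1.2 ∈ frontier β.region := fun i =>
    (tendsto_coordLine u i).eventually hb
  set n := β.normal (Φ u).1.2 with hn
  set w := velocity (Φ u) with hw
  have hnn : dot n n = 1 := hβ.dot_normal_self hbu
  -- the centre moves along the boundary
  have hda : ∀ i, da i = dot (da i) (Complex.I * n) • (Complex.I * n) := fun i => by
    obtain ⟨W, g, hW, hg⟩ := hβ.exists_boundaryChart hbu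
    obtain ⟨c, hc, hcv⟩ := hg.exists_fderiv_eq hβ hW hbu
    have hgd : HasFDerivAt g (fderiv ℝ g (Φ u).1.2) (coordLine Φ u i 0).1.2 := by
      rw [coordLine_zero]
      exact ((hg.contDiffOn.differentiableOn (by simp)).differentiableAt
        (hg.isOpen.mem_nhds hW)).hasFDerivAt
    have h1 := hgd.comp_hasDerivAt 0 (h i).center
    have h2 : HasDerivAt (fun _ : ℝ => (0 : ℝ)) _ 0 := h1.congr_of_eventuallyEq (by
      have hWe := (h i).center.continuousAt.preimage_mem_nhds
        (t := W) (hg.isOpen.mem_nhds (by rwa [coordLine_zero]))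
      filter_upwards [hb0 i, hWe] with t ht htW
      exact ((hg.mem_frontier_iff htW).1 ht).symm)
    have h3 := h2.unique (hasDerivAt_const _ _)
    rw [hcv] at h3
    have h4 : dot (da i) n = 0 := by
      rcases mul_eq_zero.1 h3 with h5 | h5
      · linarith
      · exact h5
    conv_lhs => rw [eq_dot_smul_add hnn (da i), h4, zero_smul, zero_add]
  -- derivative of the normal
  obtain ⟨ν, hνs, hν⟩ := hβ.exists_contDiffAt_normal hbu
  set D := fderiv ℝ ν (Φ u).1.2
  have hνd : ∀ i, HasDerivAt (fun t => β.normal (coordLine Φ u i t).1.2) (D (da i)) 0 := fun i => by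
    have hD : HasFDerivAt ν D (coordLine Φ u i 0).1.2 := by
      rw [coordLine_zero]
      exact (hνs.differentiableAt (by simp)).hasFDerivAt
    refine (hD.comp_hasDerivAt 0 (h i).center).congr_of_eventuallyEq ?_
    have ht := (h i).center.continuousAt.tendsto
    rw [coordLine_zero] at ht
    filter_upwards [hb0 i, ht.eventually hν] with t h1 h2
    exact (h2 h1).symm
  set α := β.collisionFactor with hα
  set κ := α / (2 * β.inertia) * (2 * β.radius) with hκ
  set slip := β.slip (Φ u) with hslip
  set dslip : Fin 4 → ℝ := fun i => β.radius * ds i +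
    (dot (dw i) (Complex.I * n) + dot w (Complex.I * D (da i))) with hdslip
  have hsl : ∀ i, HasDerivAt (fun t => β.slip (coordLine Φ u i t)) (dslip i) 0 := fun i => by
    have h1 := ((h i).spin.const_mul β.radius).add
      (hasDerivAt_dot (h i).vel ((hνd i).const_mul Complex.I))
    simp only [coordLine_zero] at h1
    exact h1
  have h' : ∀ i, HasCoordDeriv (coordLine (fun v => β.collide (Φ v)) u i) (dφ i) (da i)
      (ds i - κ * dslip i)
      (dw i - ((2 * α * slip) • (Complex.I * D (da i)) + (2 * α * dslip i) • (Complex.I * n))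
        - ((2 * dot w n) • D (da i) + (2 * (dot (dw i) n + dot w (D (da i)))) • n)) := fun i => by
    refine ⟨(h i).angle, (h i).center, ?_, ?_⟩
    · refine ((h i).spin.sub ((hsl i).const_mul κ)).congr_of_eventuallyEq ?_
      filter_upwards [hb0 i] with t ht
      refine (collide_spin hβ ht).trans ?_
      simp only [Pi.sub_apply, hκ, hα]
      ring
    · have h1 := ((h i).vel.sub (((hsl i).const_mul (2 * α)).smul
        ((hνd i).const_mul Complex.I))).sub
        (((hasDerivAt_dot (h i).vel (hνd i)).const_mul 2).smul (hνd i))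
      simp only [coordLine_zero] at h1
      refine h1.congr_of_eventuallyEq ?_
      filter_upwards [hb0 i] with t ht
      exact velocity_collide hβ ht
  set s : Fin 4 → ℝ := fun i => dot (da i) (Complex.I * n) with hs
  set r : Fin 4 → ℝ := fun i => dot (dw i) (Complex.I * n) with hr
  set N := D (Complex.I * n) with hN
  have hDa : ∀ i, D (da i) = s i • N := fun i => by
    rw [hda i, map_smul]
  have hdot : ∀ (v : ℂ) (i : Fin 4), dot v (da i) = dot v (Complex.I * n) * s i := fun v i => by
    rw [hda i, dot_comm, dot_smul_left, dot_comm v, mul_comm]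
  -- Since `da` is tangent to the boundary, only the tangential component `r` of `dw` enters the
  -- form.
  have hin : β.coordForm dφ da ds dw = fun i j => β.mass * (2 * β.inertia *
      (ds i * dφ j - ds j * dφ i) + r i * s j - r j * s i) := by
    ext i j; simp only [coordForm, hdot, hr]
  rw [pullbackDensity_eq hΦ h, pullbackDensity_eq hΦ' h', hin]
  -- The derivative of the normal enters only through multiples of `s`, the displacement along the
  -- boundary; these are the curvature terms.
  have hout : β.coordForm dφ da (fun i => ds i - κ * dslip i) (fun i => dw i
      - ((2 * α * slip) • (Complex.I * D (da i)) + (2 * α * dslip i) • (Complex.I * n))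
      - ((2 * dot w n) • D (da i) + (2 * (dot (dw i) n + dot w (D (da i)))) • n))
    = fun i j => β.mass * (2 * β.inertia *
      (((1 - κ * β.radius) * ds i + (-κ) * r i + (-κ * dot w (Complex.I * N)) * s i) * dφ j
      - ((1 - κ * β.radius) * ds j + (-κ) * r j + (-κ * dot w (Complex.I * N)) * s j) * dφ i)
      + ((-2 * α * β.radius) * ds i + (1 - 2 * α) * r i
        + (-2 * α * slip * dot N n - 2 * α * dot w (Complex.I * N)
          - 2 * dot w n * dot N (Complex.I * n)) * s i) * s j
      - ((-2 * α * β.radius) * ds j + (1 - 2 * α) * r j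
        + (-2 * α * slip * dot N n - 2 * α * dot w (Complex.I * N)
          - 2 * dot w n * dot N (Complex.I * n)) * s j) * s i) := by
    ext i j
    have e1 : ∀ i, dot w (Complex.I * s i • N) = s i * dot w (Complex.I * N) := fun i => by
      simp [dot]; ring
    have e2 : ∀ i, dot (Complex.I * s i • N) (Complex.I * n) = s i * dot N n := fun i => by
      rw [dot_I_mul_I_mul, dot_smul_left]
    have e3 := dot_I_mul_self n
    have e4 : dot (Complex.I * n) (Complex.I * n) = 1 := by rw [dot_I_mul_I_mul, hnn]
    simp only [coordForm, hdot, hdslip, hDa, sub_eq_add_neg, dot_add_left, dot_neg_left,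
      dot_smul_left, e1, e2, e3, e4]
    simp only [hr]
    ring
  rw [hout, wedgeSquare_linear_change]
  -- On spin and tangential velocity the collision fixes the non-slipping line and negates the slip:
  -- eigenvalues `1` and `-1`.
  have hdet : (1 - κ * β.radius) * (1 - 2 * α) - (-κ) * (-2 * α * β.radius) = -1 := by
    have h1 := hβ.collisionFactor_spec
    have h2 := hβ.inertia_pos
    rw [← hα] at h1
    rw [hκ]
    field_simp
    linear_combination (-1) * h1
  rw [hdet, neg_one_mul, abs_neg]

end DiscBilliard

end RoughBilliard

/-! ### Regularity of the billiard map -/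

namespace RoughBilliard

lemma isInducing_embed : IsInducing embed :=
  (IsInducing.prodMap (IsInducing.prodMap IsInducing.subtypeVal IsInducing.id)
    IsInducing.id)

lemma continuous_velocity : Continuous velocity := by
  unfold velocity; fun_prop

namespace DiscBilliard

section Regularity

variable {V : Type*} [NormedAddCommGroup V] [NormedSpace ℝ V]

lemma contDiffAt_embed_iff {Φ : V → State} {u : V} :
    ContDiffAt ℝ ∞ (fun v => embed (Φ v)) u ↔
      ContDiffAt ℝ ∞ (fun v => ((Φ v).1.1 : ℂ)) u ∧ ContDiffAt ℝ ∞ (fun v => (Φ v).1.2) u ∧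
      ContDiffAt ℝ ∞ (fun v => (Φ v).2.1) u ∧ ContDiffAt ℝ ∞ (fun v => velocity (Φ v)) u := by
  constructor
  · intro h
    have hA : ContDiffAt ℝ ∞ (fun v => ((Φ v).1.1 : ℂ)) u := h.fst.fst
    have hz : ContDiffAt ℝ ∞ (fun v => (Φ v).2.2) u := h.snd.snd
    exact ⟨hA, h.fst.snd, h.snd.fst, hA.mul hz⟩
  · rintro ⟨hA, ha, hs, hw⟩
    have hz : ContDiffAt ℝ ∞ (fun v => (Φ v).2.2) u := by
      have h1 : ContDiffAt ℝ ∞ (fun v => star ((Φ v).1.1 : ℂ)) u :=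
        Complex.conjCLE.contDiff.contDiffAt.comp u hA
      simpa only [star_mul_velocity] using h1.mul hw
    exact (hA.prodMk ha).prodMk (hs.prodMk hz)

lemma contDiffAt_embed_reverse {Φ : V → State} {u : V}
    (h : ContDiffAt ℝ ∞ (fun v => embed (Φ v)) u) :
    ContDiffAt ℝ ∞ (fun v => embed (reverse (Φ v))) u := by
  obtain ⟨hA, ha, hs, hw⟩ := contDiffAt_embed_iff.1 h
  exact contDiffAt_embed_iff.2 ⟨hA, ha, hs.neg, by simpa only [velocity_reverse] using hw.neg⟩

lemma contDiffAt_embed_freeMotion {Φ : V → State} {τ : V → ℝ} {u : V}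
    (h : ContDiffAt ℝ ∞ (fun v => embed (Φ v)) u) (hτ : ContDiffAt ℝ ∞ τ u) :
    ContDiffAt ℝ ∞ (fun v => embed (freeMotion (τ v) (Φ v))) u := by
  obtain ⟨hA, ha, hs, hw⟩ := contDiffAt_embed_iff.1 h
  refine contDiffAt_embed_iff.2 ⟨?_, ?_, hs, by simpa only [velocity_freeMotion] using hw⟩
  · simp only [freeMotion, Circle.coe_mul, Circle.coe_exp]
    have h1 : ContDiffAt ℝ ∞ (fun v => ((τ v * (Φ v).2.1 : ℝ) : ℂ)) u :=
      Complex.ofRealCLM.contDiff.contDiffAt.comp u (hτ.mul hs)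
    exact hA.mul (h1.mul contDiffAt_const).cexp
  · simp only [freeMotion_center]
    exact ha.add (hτ.smul hw)

lemma contDiffAt_dot {f g : V → ℂ} {u : V} (hf : ContDiffAt ℝ ∞ f u) (hg : ContDiffAt ℝ ∞ g u) :
    ContDiffAt ℝ ∞ (fun v => dot (f v) (g v)) u :=
  contDiff_dot.contDiffAt.comp u (hf.prodMk hg)

lemma contDiffAt_embed_collide {β : DiscBilliard} (hβ : β.Regular) {Φ : V → State} {u : V}
    (h : ContDiffAt ℝ ∞ (fun v => embed (Φ v)) u)
    (hb : ∀ᶠ v in 𝓝 u, (Φ v).1.2 ∈ frontier β.region) :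
    ContDiffAt ℝ ∞ (fun v => embed (β.collide (Φ v))) u := by
  obtain ⟨hA, ha, hs, hw⟩ := contDiffAt_embed_iff.1 h
  obtain ⟨ν, hν, hνe⟩ := hβ.exists_contDiffAt_normal hb.self_of_nhds
  have hn : ContDiffAt ℝ ∞ (fun v => β.normal (Φ v).1.2) u := by
    refine (hν.comp u ha).congr_of_eventuallyEq ?_
    filter_upwards [hb, ha.continuousAt.eventually hνe] with v h1 h2
    exact (h2 h1).symm
  have hIn : ContDiffAt ℝ ∞ (fun v => Complex.I * β.normal (Φ v).1.2) u :=
    contDiffAt_const.mul hn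
  have hsl : ContDiffAt ℝ ∞ (fun v => β.slip (Φ v)) u :=
    (contDiffAt_const.mul hs).add (contDiffAt_dot hw hIn)
  refine contDiffAt_embed_iff.2 ⟨hA, ha, ?_, ?_⟩
  · refine (hs.sub (contDiffAt_const.mul (contDiffAt_const.mul hsl))).congr_of_eventuallyEq
      (hb.mono fun v hv => collide_spin hβ hv)
  · refine ((hw.sub ((contDiffAt_const.mul hsl).smul hIn)).sub
      ((contDiffAt_const.mul (contDiffAt_dot hw hn)).smul hn)).congr_of_eventuallyEq
      (hb.mono fun v hv => velocity_collide hβ hv)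

end Regularity

lemma continuousWithinAt_state {X : Type*} [TopologicalSpace X] {f : X → State} {s : Set X} {x : X}
    (h1 : ContinuousWithinAt (fun y => (f y).1) s x)
    (h2 : ContinuousWithinAt (fun y => (f y).2.1) s x)
    (h3 : ContinuousWithinAt (fun y => velocity (f y)) s x) : ContinuousWithinAt f s x := by
  have hz : ContinuousWithinAt (fun y => (f y).2.2) s x := by
    have hc : Continuous fun A : Circle => star (A : ℂ) := by fun_prop
    have hA : ContinuousWithinAt (fun y => star ((f y).1.1 : ℂ)) s x :=
      hc.continuousAt.comp_continuousWithinAt h1.fst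
    exact (hA.mul h3).congr (fun y _ => (star_mul_velocity (f y)).symm)
      (star_mul_velocity (f x)).symm
  exact h1.prodMk (h2.prodMk hz)

lemma continuous_freeMotion : Continuous fun p : ℝ × State => freeMotion p.1 p.2 := by
  unfold freeMotion; fun_prop

variable {β : DiscBilliard} {E : ℝ}

lemma Regular.continuousOn_normal (hβ : β.Regular) :
    ContinuousOn β.normal (frontier β.region) := fun a ha => by
  obtain ⟨ν, hν, hνe⟩ := hβ.exists_contDiffAt_normal ha
  refine hν.continuousAt.continuousWithinAt.congr_of_eventuallyEq ?_ (hνe.self_of_nhds ha).symm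
  filter_upwards [mem_nhdsWithin_of_mem_nhds hνe, self_mem_nhdsWithin] with x h1 h2
  exact (h1 h2).symm

lemma Regular.continuousOn_collide (hβ : β.Regular) :
    ContinuousOn β.collide {x | x.1.2 ∈ frontier β.region} := fun x hx => by
  set S : Set State := {x | x.1.2 ∈ frontier β.region}
  have hn : ContinuousWithinAt (fun y : State => β.normal y.1.2) S x :=
    ContinuousWithinAt.comp (f := fun y : State => y.1.2) (hβ.continuousOn_normal x.1.2 hx)
      (by fun_prop) fun y hy => hy
  have hw : ContinuousWithinAt velocity S x := continuous_velocity.continuousWithinAt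
  have hIn : ContinuousWithinAt (fun y : State => Complex.I * β.normal y.1.2) S x :=
    continuousWithinAt_const.mul hn
  have hd : ∀ {f : State → ℂ}, ContinuousWithinAt f S x →
      ContinuousWithinAt (fun y => dot (velocity y) (f y)) S x := fun hf =>
    continuous_dot.continuousAt.comp_continuousWithinAt (hw.prodMk hf)
  have hs : ContinuousWithinAt (fun y : State => y.2.1) S x := by fun_prop
  have hsl : ContinuousWithinAt β.slip S x := (continuousWithinAt_const.mul hs).add (hd hIn)
  refine continuousWithinAt_state (f := β.collide) (by simp only [collide]; fun_prop) ?_ ?_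
  · exact (hs.sub (continuousWithinAt_const.mul (continuousWithinAt_const.mul hsl))).congr
      (fun y hy => collide_spin hβ hy) (collide_spin hβ hx)
  · exact ((hw.sub ((continuousWithinAt_const.mul hsl).smul hIn)).sub
      ((continuousWithinAt_const.mul (hd hn)).smul hn)).congr
      (fun y hy => velocity_collide hβ hy) (velocity_collide hβ hx)

lemma isLeast_hitTimes (hβ : β.Regular) {x : State} (hx : x ∈ β.postCollision E)
    (hne : (β.hitTimes x).Nonempty) :
    IsLeast (β.lineHits (x.1.2, velocity x)) (sInf (β.hitTimes x)) := by
  obtain ⟨h1, -, h3⟩ := mem_postCollision.1 hx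
  rw [hitTimes_eq] at hne ⊢
  exact hβ.isLeast_sInf_lineHits h1 h3 hne

/-- Replaces the infimum in the definition by an attained first hitting time, available because the
departure is transversal. -/
lemma mem_domain_iff (hβ : β.Regular) {x : State} : x ∈ β.domain E ↔ x ∈ β.postCollision E ∧
    ∃ τ, IsLeast (β.lineHits (x.1.2, velocity x)) τ ∧
      0 < dot (velocity x) (β.normal (x.1.2 + τ • velocity x)) := by
  constructor
  · rintro ⟨h1, h2, h3⟩
    rw [dot_bodyNormal, nextPreCollision, velocity_freeMotion, freeMotion_center] at h3
    exact ⟨h1, _, isLeast_hitTimes hβ h1 h2, h3⟩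
  · rintro ⟨h1, τ, hτ, h3⟩
    have hne : (β.hitTimes x).Nonempty := by rw [hitTimes_eq]; exact ⟨τ, hτ.1⟩
    refine ⟨h1, hne, ?_⟩
    rw [dot_bodyNormal, nextPreCollision, velocity_freeMotion, freeMotion_center,
      (isLeast_hitTimes hβ h1 hne).unique hτ]
    exact h3

lemma billiardMap_eq (hβ : β.Regular) {x : State} (hx : x ∈ β.domain E) {τ : ℝ}
    (hτ : IsLeast (β.lineHits (x.1.2, velocity x)) τ) :
    β.billiardMap E x = β.collide (freeMotion τ x) := by
  rw [billiardMap, if_pos hx, nextPreCollision, (isLeast_hitTimes hβ hx.1 hx.2.1).unique hτ]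
  rfl

/-- Near a point of its domain, the billiard map is the free motion up to a smooth time, followed
by a collision. -/
lemma exists_local_form (hβ : β.Regular) {x₀ : State} (hx₀ : x₀ ∈ β.domain E) :
    ∃ T : ℂ × ℂ → ℝ, ContDiffAt ℝ ∞ T (x₀.1.2, velocity x₀) ∧
      ∀ᶠ x in 𝓝[β.postCollision E] x₀, x ∈ β.domain E ∧
        (freeMotion (T (x.1.2, velocity x)) x).1.2 ∈ frontier β.region ∧
        β.billiardMap E x = β.collide (freeMotion (T (x.1.2, velocity x)) x) := by
  obtain ⟨hN, τ, hτ, hpos⟩ := (mem_domain_iff hβ).1 hx₀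
  obtain ⟨h1, -, h3⟩ := mem_postCollision.1 hN
  obtain ⟨T, hTs, hT0, hev⟩ := hβ.exists_return_time h1 h3 hτ hpos
  refine ⟨T, hTs, ?_⟩
  have hp : Continuous fun x : State => (x.1.2, velocity x) := by
    have := continuous_velocity; fun_prop
  -- The normal is meaningful only on the frontier, so transversality is carried to nearby arrivals
  -- by its smooth extension `ν`.
  have htr : ∀ᶠ p : ℂ × ℂ in 𝓝 (x₀.1.2, velocity x₀), p.1 + T p • p.2 ∈ frontier β.region →
      0 < dot p.2 (β.normal (p.1 + T p • p.2)) := by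
    obtain ⟨ν, hν, hνe⟩ := hβ.exists_contDiffAt_normal hτ.1.2
    have hc : ContinuousAt (fun p : ℂ × ℂ => p.1 + T p • p.2) (x₀.1.2, velocity x₀) :=
      continuousAt_fst.add (hTs.continuousAt.smul continuousAt_snd)
    have hc' : Tendsto (fun p : ℂ × ℂ => p.1 + T p • p.2) (𝓝 (x₀.1.2, velocity x₀))
        (𝓝 (x₀.1.2 + τ • velocity x₀)) := by
      simpa [ContinuousAt, hT0] using hc
    have hd : Tendsto (fun p : ℂ × ℂ => dot p.2 (ν (p.1 + T p • p.2)))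
        (𝓝 (x₀.1.2, velocity x₀))
        (𝓝 (dot (velocity x₀) (β.normal (x₀.1.2 + τ • velocity x₀)))) := by
      rw [← hνe.self_of_nhds hτ.1.2]
      exact (continuous_dot.tendsto _).comp
        ((continuous_snd.tendsto (x₀.1.2, velocity x₀)).prodMk_nhds
          (hν.continuousAt.tendsto.comp hc'))
    filter_upwards [hd.eventually (lt_mem_nhds hpos), hc'.eventually hνe] with p hp1 hp2 hp3
    rwa [← hp2 hp3]
  filter_upwards [self_mem_nhdsWithin,
    mem_nhdsWithin_of_mem_nhds ((hp.tendsto x₀).eventually hev),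
    mem_nhdsWithin_of_mem_nhds ((hp.tendsto x₀).eventually htr)] with x hx h4 h5
  have hl := h4 (mem_postCollision.1 hx).1
  have hxD : x ∈ β.domain E := (mem_domain_iff hβ).2 ⟨hx, _, hl, h5 hl.1.2⟩
  exact ⟨hxD, hl.1.2, billiardMap_eq hβ hxD hl⟩

lemma continuousOn_billiardMap (hβ : β.Regular) :
    ContinuousOn (β.billiardMap E) (β.domain E) := fun x₀ hx₀ => by
  obtain ⟨T, hT, hev⟩ := exists_local_form hβ hx₀
  have hsub : β.domain E ⊆ β.postCollision E := fun x hx => hx.1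
  refine ContinuousWithinAt.mono ?_ hsub
  have h0 := hev.self_of_nhdsWithin hx₀.1
  have hp : Continuous fun x : State => (x.1.2, velocity x) := by
    have := continuous_velocity; fun_prop
  have hTc : ContinuousAt (fun x : State => T (x.1.2, velocity x)) x₀ :=
    ContinuousAt.comp (f := fun x : State => (x.1.2, velocity x)) hT.continuousAt hp.continuousAt
  have hF : ContinuousAt (fun x : State => freeMotion (T (x.1.2, velocity x)) x) x₀ :=
    ContinuousAt.comp (f := fun x : State => (T (x.1.2, velocity x), x))
      continuous_freeMotion.continuousAt (hTc.prodMk continuousAt_id)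
  have hF' : Tendsto (fun x : State => freeMotion (T (x.1.2, velocity x)) x)
      (𝓝[β.postCollision E] x₀) (𝓝[{x | x.1.2 ∈ frontier β.region}]
        freeMotion (T (x₀.1.2, velocity x₀)) x₀) :=
    tendsto_nhdsWithin_iff.2 ⟨hF.tendsto.mono_left nhdsWithin_le_nhds,
      hev.mono fun x hx => hx.2.1⟩
  have hC : Tendsto (fun x : State => β.collide (freeMotion (T (x.1.2, velocity x)) x))
      (𝓝[β.postCollision E] x₀) (𝓝 (β.billiardMap E x₀)) := by
    rw [h0.2.2]
    exact Tendsto.comp (hβ.continuousOn_collide _ h0.2.1) hF'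
  exact hC.congr' (hev.mono fun x hx => hx.2.2.symm)

lemma continuous_energy (β : DiscBilliard) : Continuous fun x : State => β.energy x.2 := by
  unfold energy metric dot; fun_prop

lemma measurableSet_postCollision (hβ : β.Regular) : MeasurableSet (β.postCollision E) := by
  have hcl : IsClosed {x : State | x.1.2 ∈ frontier β.region} :=
    isClosed_frontier.preimage (by fun_prop)
  have hd : ContinuousOn (fun x : State => dot (velocity x) (β.normal x.1.2))
      {x | x.1.2 ∈ frontier β.region} :=
    continuous_dot.comp_continuousOn (continuous_velocity.continuousOn.prodMk
      (hβ.continuousOn_normal.comp (Continuous.continuousOn (by fun_prop)) fun x hx => hx))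
  obtain ⟨O, hO, hOe⟩ := continuousOn_iff'.1 hd (Iio 0) isOpen_Iio
  have e : β.postCollision E
      = (O ∩ {x | x.1.2 ∈ frontier β.region}) ∩ {x | β.energy x.2 = E} := by
    rw [← hOe]
    ext x
    rw [mem_postCollision]
    constructor
    · rintro ⟨h1, h2, h3⟩; exact ⟨⟨h3, h1⟩, h2⟩
    · rintro ⟨⟨h3, h1⟩, h2⟩; exact ⟨h1, h2, h3⟩
  rw [e]
  exact (hO.measurableSet.inter hcl.measurableSet).inter
    (isClosed_eq β.continuous_energy continuous_const).measurableSet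

/-- The domain is relatively open in the post-collision states: nearby departures also have a
transversal first arrival. -/
lemma measurableSet_domain (hβ : β.Regular) : MeasurableSet (β.domain E) := by
  have h : ∀ x ∈ β.domain E, ∃ O, IsOpen O ∧ x ∈ O ∧ O ∩ β.postCollision E ⊆ β.domain E := by
    intro x hx
    obtain ⟨T, -, hev⟩ := exists_local_form hβ hx
    obtain ⟨O, hO, hxO, hsub⟩ := mem_nhdsWithin.1 (hev.mono fun y hy => hy.1)
    exact ⟨O, hO, hxO, hsub⟩
  choose! O hO hxO hsub using h
  have e : β.domain E = (⋃ x ∈ β.domain E, O x) ∩ β.postCollision E := by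
    ext y
    constructor
    · exact fun hy => ⟨mem_biUnion hy (hxO y hy), hy.1⟩
    · rintro ⟨hy, hyN⟩
      obtain ⟨x, hx, hyx⟩ := mem_iUnion₂.1 hy
      exact hsub x hx ⟨hyx, hyN⟩
  rw [e]
  exact (isOpen_biUnion fun x hx => hO x hx).measurableSet.inter (measurableSet_postCollision hβ)

/-! ### Time reversal and injectivity -/

lemma freeMotion_reverse (t : ℝ) (x : State) :
    freeMotion t (reverse x) = reverse (freeMotion (-t) x) := by
  simp [freeMotion, reverse]

lemma reverse_reverse (x : State) : reverse (reverse x) = x := by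
  simp [reverse]

lemma energy_reverse (x : State) : β.energy (reverse x).2 = β.energy x.2 := by
  rw [energy_eq, energy_eq, velocity_reverse]
  simp [reverse, dot]

lemma collide_reverse (hβ : β.Regular) {x : State} (hx : x.1.2 ∈ frontier β.region) :
    β.collide (reverse x) = reverse (β.collide x) := by
  have hx' : (reverse x).1.2 ∈ frontier β.region := hx
  have hs : β.slip (reverse x) = -β.slip x := by
    simp only [slip, velocity_reverse, dot_neg_left]
    simp [reverse]; ring
  have hc : (reverse x).1 = x.1 := rfl
  refine state_ext rfl ?_ ?_
  · rw [collide_spin hβ hx', hs]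
    simp only [reverse, Prod.fst_neg]
    rw [collide_spin hβ hx]; ring
  · rw [velocity_collide hβ hx', hs, velocity_reverse, velocity_reverse, velocity_collide hβ hx,
      hc, dot_neg_left]
    simp only [mul_neg, neg_smul]
    abel

variable (β) in
/-- The involution of the space of post-collision states that conjugates the billiard map to its
inverse. -/
def timeReversal (x : State) : State := reverse (β.collide x)

lemma timeReversal_timeReversal (hβ : β.Regular) {x : State} (hx : x.1.2 ∈ frontier β.region) :
    β.timeReversal (β.timeReversal x) = x := by
  have hx' : (β.collide x).1.2 ∈ frontier β.region := hx
  rw [timeReversal, timeReversal, collide_reverse hβ hx', reverse_reverse, collide_collide hβ hx]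

lemma timeReversal_mem (hβ : β.Regular) {x : State} (hx : x ∈ β.postCollision E) :
    β.timeReversal x ∈ β.postCollision E := by
  obtain ⟨h1, h2, h3⟩ := mem_postCollision.1 hx
  refine mem_postCollision.2 ⟨h1, ?_, ?_⟩
  · rw [timeReversal, energy_reverse, energy_collide hβ h1, h2]
  · rw [timeReversal, velocity_reverse, dot_neg_left]
    have := dot_velocity_collide hβ h1
    change -dot (velocity (β.collide x)) (β.normal x.1.2) < 0
    linarith

lemma energy_freeMotion (t : ℝ) (x : State) : β.energy (freeMotion t x).2 = β.energy x.2 := by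
  rw [energy_eq, energy_eq, velocity_freeMotion]; rfl

lemma billiardMap_mem (hβ : β.Regular) {x : State} (hx : x ∈ β.domain E) :
    β.billiardMap E x ∈ β.postCollision E := by
  obtain ⟨hN, τ, hτ, hpos⟩ := (mem_domain_iff hβ).1 hx
  have hb : (freeMotion τ x).1.2 ∈ frontier β.region := hτ.1.2
  rw [billiardMap_eq hβ hx hτ]
  refine mem_postCollision.2 ⟨hb, ?_, ?_⟩
  · rw [energy_collide hβ hb, energy_freeMotion, (mem_postCollision.1 hN).2.1]
  · have := dot_velocity_collide hβ hb
    change dot (velocity (β.collide (freeMotion τ x))) (β.normal (freeMotion τ x).1.2) < 0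
    rw [this, velocity_freeMotion, freeMotion_center]
    linarith

/-- Undoing the collision and reversing the velocity sends the disc back along the same segment. Its
interior misses the boundary, so the first return takes the same time `τ` and ends at the starting
point, where the departure, transversal by assumption, becomes a transversal arrival. -/
lemma timeReversal_billiardMap (hβ : β.Regular) {x : State} (hx : x ∈ β.domain E) :
    β.timeReversal (β.billiardMap E x) ∈ β.domain E ∧
      β.billiardMap E (β.timeReversal (β.billiardMap E x)) = β.timeReversal x := by
  obtain ⟨hN, τ, hτ, hpos⟩ := (mem_domain_iff hβ).1 hx
  obtain ⟨h1, h2, h3⟩ := mem_postCollision.1 hN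
  have hb : (freeMotion τ x).1.2 ∈ frontier β.region := hτ.1.2
  have hy : β.timeReversal (β.billiardMap E x) = reverse (freeMotion τ x) := by
    rw [billiardMap_eq hβ hx hτ, timeReversal, collide_collide hβ hb]
  have hmem := timeReversal_mem hβ (billiardMap_mem hβ hx)
  rw [hy] at hmem ⊢
  have hv : velocity (reverse (freeMotion τ x)) = -velocity x := by
    rw [velocity_reverse, velocity_freeMotion]
  have hpath : ∀ t : ℝ, (reverse (freeMotion τ x)).1.2 + t • -velocity x
      = x.1.2 + (τ - t) • velocity x := fun t => by
    change (freeMotion τ x).1.2 + t • -velocity x = _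
    rw [freeMotion_center, sub_smul, smul_neg]; abel
  have hl : IsLeast (β.lineHits ((reverse (freeMotion τ x)).1.2,
      velocity (reverse (freeMotion τ x)))) τ := by
    rw [hv]
    refine ⟨⟨hτ.1.1, ?_⟩, fun t ht => ?_⟩
    · change (reverse (freeMotion τ x)).1.2 + τ • -velocity x ∈ _
      rw [hpath, sub_self, zero_smul, add_zero]
      exact h1
    · by_contra! hlt
      have ht2 : (reverse (freeMotion τ x)).1.2 + t • -velocity x ∈ frontier β.region := ht.2
      rw [hpath] at ht2
      exact ht2.2 (hβ.mem_interior_of_lt h1 h3 hτ (by linarith) (by linarith [ht.1]))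
  have hD : reverse (freeMotion τ x) ∈ β.domain E := by
    refine (mem_domain_iff hβ).2 ⟨hmem, τ, hl, ?_⟩
    rw [hv, hpath, sub_self, zero_smul, add_zero, dot_neg_left]
    linarith
  refine ⟨hD, ?_⟩
  rw [billiardMap_eq hβ hD hl, freeMotion_reverse, freeMotion_freeMotion, neg_add_cancel,
    freeMotion_zero, collide_reverse hβ h1, timeReversal]

lemma injOn_timeReversal (hβ : β.Regular) : InjOn β.timeReversal (β.postCollision E) := by
  intro x hx y hy hxy
  rw [← timeReversal_timeReversal hβ (mem_postCollision.1 hx).1, hxy,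
    timeReversal_timeReversal hβ (mem_postCollision.1 hy).1]

/-- By $TJT=J$, the image determines $J(x)$, and $J$ is injective. -/
lemma injOn_billiardMap (hβ : β.Regular) : InjOn (β.billiardMap E) (β.domain E) := by
  intro x hx y hy hxy
  refine injOn_timeReversal hβ hx.1 hy.1 ?_
  rw [← (timeReversal_billiardMap hβ hx).2, hxy, (timeReversal_billiardMap hβ hy).2]

lemma continuousOn_timeReversal (hβ : β.Regular) :
    ContinuousOn β.timeReversal (β.postCollision E) := by
  have hr : Continuous reverse := by unfold reverse; fun_prop
  exact hr.comp_continuousOn (hβ.continuousOn_collide.mono fun x hx => (mem_postCollision.1 hx).1)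

end DiscBilliard

end RoughBilliard

/-! ### From invariance of the form to invariance of the measure -/

namespace RoughBilliard

namespace DiscBilliard

variable {β : DiscBilliard} {E : ℝ}

lemma Param.contDiffAt (φ : β.Param E) {u : Fin 4 → ℝ} (hu : u ∈ φ.source) :
    ContDiffAt ℝ ∞ (fun v => embed (φ.toFun v)) u :=
  φ.smooth.contDiffAt (φ.isOpen.mem_nhds hu)

lemma Param.continuousAt (φ : β.Param E) {u : Fin 4 → ℝ} (hu : u ∈ φ.source) :
    ContinuousAt φ.toFun u :=
  isInducing_embed.continuousAt_iff.2 (φ.contDiffAt hu).continuousAt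

lemma Param.eventually_mem (φ : β.Param E) {u : Fin 4 → ℝ} (hu : u ∈ φ.source) :
    ∀ᶠ v in 𝓝 u, φ.toFun v ∈ β.postCollision E := by
  filter_upwards [φ.isOpen.mem_nhds hu] with v hv using φ.mapsTo hv

lemma Param.tendsto (φ : β.Param E) {u : Fin 4 → ℝ} (hu : u ∈ φ.source) :
    Tendsto φ.toFun (𝓝 u) (𝓝[β.postCollision E] (φ.toFun u)) :=
  tendsto_nhdsWithin_iff.2 ⟨φ.continuousAt hu, φ.eventually_mem hu⟩

/-- The measure `|φ^* Ω|` carried by the image of a parametrisation. -/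
def paramMeasure (φ : β.Param E) : Measure State :=
  ((volume.restrict φ.source).withDensity
    (fun u => ENNReal.ofReal (β.density φ u))).map φ.toFun

lemma billiardMeasure_eq : β.billiardMeasure E = ⨆ φ : β.Param E, paramMeasure φ := rfl

lemma paramMeasure_apply (φ : β.Param E) {S : Set State} (hS : MeasurableSet S) :
    paramMeasure φ S
      = ∫⁻ u in φ.toFun ⁻¹' S ∩ φ.source, ENNReal.ofReal (β.pullbackDensity φ.toFun u) := by
  have hc : ContinuousOn φ.toFun φ.source := fun u hu => (φ.continuousAt hu).continuousWithinAt
  have hm : AEMeasurable φ.toFun (volume.restrict φ.source) :=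
    hc.aemeasurable φ.isOpen.measurableSet
  rw [paramMeasure, Measure.map_apply_of_aemeasurable
    (hm.mono_ac (withDensity_absolutelyContinuous _ _)) hS, withDensity_apply',
    Measure.restrict_restrict' φ.isOpen.measurableSet]
  rfl

lemma pullbackDensity_congr {Φ Ψ : (Fin 4 → ℝ) → State} {u : Fin 4 → ℝ} (h : Φ =ᶠ[𝓝 u] Ψ) :
    β.pullbackDensity Φ u = β.pullbackDensity Ψ u := by
  have h' : (fun v => embed (Φ v)) =ᶠ[𝓝 u] fun v => embed (Ψ v) :=
    h.mono fun v hv => congrArg embed hv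
  rw [pullbackDensity, pullbackDensity, h'.fderiv_eq, h.self_of_nhds]

variable (β E) in
/-- An injective map of a measurable set of post-collision states that carries smooth
parametrisations to smooth parametrisations and preserves the form `Ω` up to sign. -/
structure IsFormPreserving (G : State → State) (D : Set State) : Prop where
  measurableSet : MeasurableSet D
  subset : D ⊆ β.postCollision E
  mapsTo : MapsTo G D (β.postCollision E)
  injOn : InjOn G D
  continuousOn : ContinuousOn G D
  eventually_mem : ∀ (φ : β.Param E), ∀ u ∈ φ.source, φ.toFun u ∈ D →
    ∀ᶠ v in 𝓝 u, φ.toFun v ∈ D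
  contDiffAt : ∀ (φ : β.Param E), ∀ u ∈ φ.source, φ.toFun u ∈ D →
    ContDiffAt ℝ ∞ (fun v => embed (G (φ.toFun v))) u
  density_eq : ∀ (φ : β.Param E), ∀ u ∈ φ.source, φ.toFun u ∈ D →
    β.pullbackDensity (fun v => G (φ.toFun v)) u = β.pullbackDensity φ.toFun u

namespace IsFormPreserving

variable {G : State → State} {D : Set State}

/-- The image of a parametrisation. -/
def push (h : β.IsFormPreserving E G D) (φ : β.Param E) : β.Param E where
  source := φ.source ∩ φ.toFun ⁻¹' D
  toFun := fun u => G (φ.toFun u)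
  isOpen := isOpen_iff_mem_nhds.2 fun u hu =>
    inter_mem (φ.isOpen.mem_nhds hu.1) (h.eventually_mem φ u hu.1 hu.2)
  mapsTo := fun _ hu => h.mapsTo hu.2
  injOn := fun _ hu _ hv huv => φ.injOn hu.1 hv.1 (h.injOn hu.2 hv.2 huv)
  smooth := fun u hu => (h.contDiffAt φ u hu.1 hu.2).contDiffWithinAt

lemma measurableSet_image (h : β.IsFormPreserving E G D) {S : Set State} (hSD : S ⊆ D)
    (hS : MeasurableSet S) : MeasurableSet (G '' S) :=
  hS.image_of_continuousOn_injOn (h.continuousOn.mono hSD) (h.injOn.mono hSD)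

/-- Both sides integrate the same density over the same set of parameters, by injectivity of `G` and
preservation of the form. -/
lemma paramMeasure_push (h : β.IsFormPreserving E G D) (φ : β.Param E) {S : Set State}
    (hSD : S ⊆ D) (hS : MeasurableSet S) :
    paramMeasure (h.push φ) (G '' S) = paramMeasure φ S := by
  rw [paramMeasure_apply _ (h.measurableSet_image hSD hS), paramMeasure_apply _ hS]
  have e : (h.push φ).toFun ⁻¹' (G '' S) ∩ (h.push φ).source = φ.toFun ⁻¹' S ∩ φ.source := by
    ext u
    constructor
    · rintro ⟨⟨x, hx, hxu⟩, hu, huD⟩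
      have hxe : x = φ.toFun u := h.injOn (hSD hx) huD hxu
      exact ⟨by rwa [mem_preimage, ← hxe], hu⟩
    · rintro ⟨huS, hu⟩
      exact ⟨mem_image_of_mem G huS, hu, hSD huS⟩
  have hm : MeasurableSet (φ.toFun ⁻¹' S ∩ φ.source) := by
    have hc : ContinuousOn φ.toFun φ.source := fun u hu => (φ.continuousAt hu).continuousWithinAt
    have hd := hc.domRestrict.measurable hS
    have := φ.isOpen.measurableSet.subtype_image hd
    convert this using 1
    ext u
    simp [and_comm]
  rw [e]
  refine setLIntegral_congr_fun hm fun u hu => ?_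
  change ENNReal.ofReal (β.pullbackDensity (fun v => G (φ.toFun v)) u) = _
  rw [h.density_eq φ u hu.2 (hSD hu.1)]

/-- A supremum of measures is not computed set by set, so a whole measure is compared: pull the
billiard measure back by `G` on `D`, keep it unchanged off `D`, and check that the sum dominates
every `paramMeasure`. Smoothness of the inverse of `G` is not needed for this inequality. -/
lemma measure_le (h : β.IsFormPreserving E G D) {S : Set State} (hSD : S ⊆ D)
    (hS : MeasurableSet S) : β.billiardMeasure E S ≤ β.billiardMeasure E (G '' S) := by
  set μ := β.billiardMeasure E with hμ
  set g : D → State := fun x => G x with hg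
  have hgi : Function.Injective g := fun x y hxy => Subtype.ext (h.injOn x.2 y.2 hxy)
  have himg : ∀ s : Set D, g '' s = G '' (Subtype.val '' s) := fun s => by
    rw [image_image]
  have hgm : ∀ s : Set D, MeasurableSet s → MeasurableSet (g '' s) := fun s hs => by
    rw [himg]
    exact h.measurableSet_image (by rintro _ ⟨x, -, rfl⟩; exact x.2)
      (h.measurableSet.subtype_image hs)
  set ν : Measure State := (μ.comap g).map Subtype.val with hν
  have hνa : ∀ s, MeasurableSet s → ν s = μ (G '' (D ∩ s)) := fun s hs => by
    rw [hν, Measure.map_apply measurable_subtype_coe hs,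
      Measure.comap_apply g hgi hgm _ (measurable_subtype_coe hs), himg,
      Subtype.image_preimage_coe]
  have hle : μ ≤ ν + μ.restrict Dᶜ := by
    conv_lhs => rw [hμ, billiardMeasure_eq]
    refine iSup_le fun φ => Measure.le_iff.2 fun s hs => ?_
    rw [Measure.add_apply, hνa s hs, Measure.restrict_apply hs,
      ← measure_inter_add_sdiff s h.measurableSet]
    refine add_le_add ?_ ?_
    -- On `D`, the mass given by a parametrisation is that given by its push-forward to the image,
    -- itself one of the competitors in the supremum.
    · rw [inter_comm s D, ← h.paramMeasure_push φ inter_subset_left (h.measurableSet.inter hs)]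
      exact le_iSup (fun φ : β.Param E => paramMeasure φ) (h.push φ) _
    · exact le_iSup (fun φ : β.Param E => paramMeasure φ) φ _
  have h1 := hle S
  rw [Measure.add_apply, hνa S hS, Measure.restrict_apply hS, inter_eq_right.2 hSD,
    (disjoint_compl_right_iff_subset.2 hSD).inter_eq, measure_empty, add_zero] at h1
  exact h1

end IsFormPreserving

lemma isFormPreserving_billiardMap (hβ : β.Regular) :
    β.IsFormPreserving E (β.billiardMap E) (β.domain E) := by
  have key : ∀ (φ : β.Param E), ∀ u ∈ φ.source, φ.toFun u ∈ β.domain E →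
      (∀ᶠ v in 𝓝 u, φ.toFun v ∈ β.domain E) ∧
      ContDiffAt ℝ ∞ (fun v => embed (β.billiardMap E (φ.toFun v))) u ∧
      β.pullbackDensity (fun v => β.billiardMap E (φ.toFun v)) u
        = β.pullbackDensity φ.toFun u := by
    intro φ u hu huD
    obtain ⟨T, hT, hev⟩ := exists_local_form hβ huD
    have hev' := (φ.tendsto hu).eventually hev
    have hφ := φ.contDiffAt hu
    obtain ⟨-, ha, -, hw⟩ := contDiffAt_embed_iff.1 hφ
    have hτ : ContDiffAt ℝ ∞ (fun v => T ((φ.toFun v).1.2, velocity (φ.toFun v))) u :=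
      ContDiffAt.comp (f := fun v => ((φ.toFun v).1.2, velocity (φ.toFun v))) u hT (ha.prodMk hw)
    have hF := contDiffAt_embed_freeMotion hφ hτ
    have hC := contDiffAt_embed_collide hβ hF (hev'.mono fun v hv => hv.2.1)
    have heq : (fun v => β.billiardMap E (φ.toFun v)) =ᶠ[𝓝 u] fun v => β.collide
        (freeMotion (T ((φ.toFun v).1.2, velocity (φ.toFun v))) (φ.toFun v)) :=
      hev'.mono fun v hv => hv.2.2
    refine ⟨hev'.mono fun v hv => hv.1,
      hC.congr_of_eventuallyEq (heq.mono fun v hv => congrArg embed hv), ?_⟩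
    rw [pullbackDensity_congr heq,
      pullbackDensity_collide hβ (hF.differentiableAt (by simp)) (hC.differentiableAt (by simp))
        (hev'.mono fun v hv => hv.2.1)]
    exact pullbackDensity_freeMotion (hφ.differentiableAt (by simp))
      (hF.differentiableAt (by simp)) (hτ.differentiableAt (by simp))
      ((φ.eventually_mem hu).mono fun v hv => (mem_postCollision.1 hv).2.1)
  exact ⟨measurableSet_domain hβ, fun x hx => hx.1, fun x hx => billiardMap_mem hβ hx,
    injOn_billiardMap hβ, continuousOn_billiardMap hβ, fun φ u hu h => (key φ u hu h).1,
    fun φ u hu h => (key φ u hu h).2.1, fun φ u hu h => (key φ u hu h).2.2⟩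

lemma isFormPreserving_timeReversal (hβ : β.Regular) :
    β.IsFormPreserving E β.timeReversal (β.postCollision E) := by
  have key : ∀ (φ : β.Param E), ∀ u ∈ φ.source,
      ContDiffAt ℝ ∞ (fun v => embed (β.timeReversal (φ.toFun v))) u ∧
      β.pullbackDensity (fun v => β.timeReversal (φ.toFun v)) u
        = β.pullbackDensity φ.toFun u := by
    intro φ u hu
    have hφ := φ.contDiffAt hu
    have hb : ∀ᶠ v in 𝓝 u, (φ.toFun v).1.2 ∈ frontier β.region :=
      (φ.eventually_mem hu).mono fun v hv => (mem_postCollision.1 hv).1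
    have hC := contDiffAt_embed_collide hβ hφ hb
    have hR := contDiffAt_embed_reverse hC
    refine ⟨hR, ?_⟩
    exact (pullbackDensity_reverse (hC.differentiableAt (by simp))
      (hR.differentiableAt (by simp))).trans (pullbackDensity_collide hβ
        (hφ.differentiableAt (by simp)) (hC.differentiableAt (by simp)) hb)
  exact ⟨measurableSet_postCollision hβ, Subset.rfl, fun x hx => timeReversal_mem hβ hx,
    injOn_timeReversal hβ, continuousOn_timeReversal hβ, fun φ u hu _ => φ.eventually_mem hu,
    fun φ u hu _ => (key φ u hu).1, fun φ u hu _ => (key φ u hu).2⟩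

/-- For an involution, the inequality applied to the image of `S` is the opposite inequality for
`S`. -/
lemma measure_timeReversal_image (hβ : β.Regular) {S : Set State} (hSN : S ⊆ β.postCollision E)
    (hS : MeasurableSet S) :
    β.billiardMeasure E (β.timeReversal '' S) = β.billiardMeasure E S := by
  have h := isFormPreserving_timeReversal (E := E) hβ
  refine le_antisymm ?_ (h.measure_le hSN hS)
  refine (h.measure_le (h.mapsTo.mono_left hSN).image_subset (h.measurableSet_image hSN hS)).trans
    (le_of_eq ?_)
  rw [image_image]
  congr 1
  ext x
  constructor
  · rintro ⟨y, hy, rfl⟩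
    change β.timeReversal (β.timeReversal y) ∈ S
    rwa [timeReversal_timeReversal hβ (mem_postCollision.1 (hSN hy)).1]
  · exact fun hx => ⟨x, hx, timeReversal_timeReversal hβ (mem_postCollision.1 (hSN hx)).1⟩

/-- The missing inequality is
$|\Omega|(TS)=|\Omega|(JTS)\le|\Omega|(TJTS)=|\Omega|(JS)=|\Omega|(S)$. -/
lemma measure_billiardMap_image (hβ : β.Regular) {S : Set State} (hSD : S ⊆ β.domain E)
    (hS : MeasurableSet S) :
    β.billiardMeasure E (β.billiardMap E '' S) = β.billiardMeasure E S := by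
  have h := isFormPreserving_billiardMap (E := E) hβ
  have hJ := isFormPreserving_timeReversal (E := E) hβ
  refine le_antisymm ?_ (h.measure_le hSD hS)
  have hT := h.measurableSet_image hSD hS
  have hTN : β.billiardMap E '' S ⊆ β.postCollision E := (h.mapsTo.mono_left hSD).image_subset
  calc β.billiardMeasure E (β.billiardMap E '' S)
      = β.billiardMeasure E (β.timeReversal '' (β.billiardMap E '' S)) :=
        (measure_timeReversal_image hβ hTN hT).symm
    _ ≤ β.billiardMeasure E
          (β.billiardMap E '' (β.timeReversal '' (β.billiardMap E '' S))) := by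
        refine h.measure_le ?_ (hJ.measurableSet_image hTN hT)
        rintro _ ⟨_, ⟨x, hx, rfl⟩, rfl⟩
        exact (timeReversal_billiardMap hβ (hSD hx)).1
    _ = β.billiardMeasure E (β.timeReversal '' S) := by
        rw [image_image, image_image]
        congr 1
        exact image_congr fun x hx => (timeReversal_billiardMap hβ (hSD hx)).2
    _ = β.billiardMeasure E S := measure_timeReversal_image hβ (fun x hx => (hSD hx).1) hS

lemma measurable_billiardMap (hβ : β.Regular) : Measurable (β.billiardMap E) := by
  refine measurable_of_restrict_of_restrict_compl (measurableSet_domain (E := E) hβ)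
    (continuousOn_billiardMap hβ).domRestrict.measurable ?_
  have e : (β.domain E)ᶜ.domRestrict (β.billiardMap E) = Subtype.val :=
    funext fun x => if_neg x.2
  rw [e]
  exact measurable_subtype_coe

/-- If $x$ and $J(x)$ both lie in $D$, then $x = T(JTJ(x))$. So a state outside the image is either
outside $D$ or in the $J$-image of the post-collision states outside $D$, and both sets are null. -/
lemma measure_compl_image_billiardMap (hβ : β.Regular)
    (hfull : ∀ᵐ x ∂β.billiardMeasure E, x ∈ β.domain E) :
    β.billiardMeasure E (β.billiardMap E '' β.domain E)ᶜ = 0 := by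
  have hD : β.billiardMeasure E (β.domain E)ᶜ = 0 := hfull
  have hm : MeasurableSet (β.postCollision E \ β.domain E) :=
    (measurableSet_postCollision hβ).diff (measurableSet_domain hβ)
  have h1 : β.billiardMeasure E (β.timeReversal '' (β.postCollision E \ β.domain E)) = 0 := by
    rw [measure_timeReversal_image hβ sdiff_subset hm]
    exact measure_mono_null (fun x hx => hx.2) hD
  refine measure_mono_null (fun x hx => ?_) (measure_union_null hD h1)
  by_cases hxD : x ∈ β.domain E
  · have hJJ := timeReversal_timeReversal hβ (mem_postCollision.1 hxD.1).1
    refine Or.inr ⟨β.timeReversal x, ⟨timeReversal_mem hβ hxD.1, fun hJ => hx ?_⟩, hJJ⟩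
    obtain ⟨h2, h3⟩ := timeReversal_billiardMap hβ hJ
    exact ⟨_, h2, h3.trans hJJ⟩
  · exact Or.inl hxD

/-- Up to null sets, a preimage may be cut down to $D$ and $S$ to $T(D)$; then $T$ maps one onto the
other and the image formula applies. -/
lemma measurePreserving_billiardMap (hβ : β.Regular)
    (hfull : ∀ᵐ x ∂β.billiardMeasure E, x ∈ β.domain E) :
    MeasurePreserving (β.billiardMap E) (β.billiardMeasure E) (β.billiardMeasure E) := by
  refine ⟨measurable_billiardMap hβ, Measure.ext fun S hS => ?_⟩
  have hm := measurable_billiardMap (E := E) hβ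
  have hD : β.billiardMeasure E (β.domain E)ᶜ = 0 := hfull
  rw [Measure.map_apply hm hS, ← measure_inter_conull hD,
    ← measure_billiardMap_image hβ inter_subset_right ((hm hS).inter (measurableSet_domain hβ)),
    inter_comm, image_inter_preimage, inter_comm,
    measure_inter_conull (measure_compl_image_billiardMap hβ hfull)]

end DiscBilliard

end RoughBilliard

end

theorem mainTheorem7 (β : RoughBilliard.DiscBilliard) (hβ : β.Regular) (E : ℝ) (hE : 0 < E) :
    -- the billiard map is a measure-preserving bijection of its domain onto its image
    (MeasurableSet (β.domain E) ∧
      Set.MapsTo (β.billiardMap E) (β.domain E) (β.postCollision E) ∧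
      Set.InjOn (β.billiardMap E) (β.domain E) ∧
      ∀ S ⊆ β.domain E, MeasurableSet S →
        MeasurableSet (β.billiardMap E '' S) ∧
          β.billiardMeasure E (β.billiardMap E '' S) = β.billiardMeasure E S) ∧
    -- the usual form of invariance, when the domain has full measure
    ((∀ᵐ x ∂β.billiardMeasure E, x ∈ β.domain E) →
      MeasurePreserving (β.billiardMap E) (β.billiardMeasure E) (β.billiardMeasure E)) := by
  have h := RoughBilliard.DiscBilliard.isFormPreserving_billiardMap (E := E) hβ
  exact ⟨⟨h.measurableSet, h.mapsTo, h.injOn, fun S hSD hS => ⟨h.measurableSet_image hSD hS,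
    RoughBilliard.DiscBilliard.measure_billiardMap_image hβ hSD hS⟩⟩,
    RoughBilliard.DiscBilliard.measurePreserving_billiardMap hβ⟩
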